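/- For $n\in\mathbb N$ let $p=p(n)\in(0,1)$ and $k=k(n)\in\{2,\dots,n\}$, and let $\mathcal H_{n,k,p}$ be the $k$-uniform binomial random hypergraph with vertex set $[n]=\{1,\dots,n\}$: every $k$-element subset of $[n]$ is an edge with probability $p$, independently of all others. For $i\in[n]$ let $X_i$ be the degree of $i$, that is, the number of edges of $\mathcal H_{n,k,p}$ containing $i$. Put $N=N(n)=\binom{n-1}{k-1}$ and, for $n$ large, \[ a_n=pN+\sqrt{2Np(1-p)\log n}\left(1-\frac{\log\log n}{4\log n}-\frac{\log(2\sqrt{\pi})}{2\log n}\right),\qquad b_n=\sqrt{\frac{Np(1-p)}{2\log n}} . \] Assume that, as $n\to\infty$, \[ \frac{\binom{n-1}{k-1}\,p(1-p)}{\log^3 n}\to\infty \qquad\text{and}\qquad \frac{k\log^2 n}{n}\to 0 . \] Then $\bigl(\max_{i\in[n]}X_i-a_n\bigr)/b_n$ converges in distribution, as $n\to\infty$, to a standard Gumbel random variable, that is, one with distribution function $x\mapsto e^{-e^{-x}}$, $x\in\mathbb R$. -/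

import Mathlib

/-- The set of all `k`-element subsets of the vertex set `Fin n`. -/
def kSubsets (n k : ℕ) : Set (Finset (Fin n)) := {e | e.card = k}

/-- The law of the `k`-uniform binomial random hypergraph on `Fin n`. A hypergraph is given by its
set of edges; every `k`-subset of the vertex set is an edge with probability `p`, independently of
the others, and no other set is an edge. -/
noncomputable def binomialHypergraph (n k : ℕ) (p : unitInterval) :
    MeasureTheory.Measure (Set (Finset (Fin n))) :=
  ProbabilityTheory.setBernoulli (kSubsets n k) p

instance instIsProbabilityMeasureBinomialHypergraph (n k : ℕ) (p : unitInterval) :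
    MeasureTheory.IsProbabilityMeasure (binomialHypergraph n k p) := by
  unfold binomialHypergraph
  infer_instance

/-- The degree of the vertex `i`: the number of edges of `H` that contain `i`. -/
noncomputable def hyperDegree {n : ℕ} (H : Set (Finset (Fin n))) (i : Fin n) : ℕ :=
  Set.ncard {e | e ∈ H ∧ i ∈ e}

/-- The maximum degree of `H`. -/
noncomputable def maxHyperDegree {n : ℕ} (H : Set (Finset (Fin n))) : ℕ :=
  Finset.univ.sup fun i : Fin n => hyperDegree H i

/-- The centring constant `a(d, N, p)`. -/
noncomputable def gumbelCenter (d N : ℕ) (p : ℝ) : ℝ :=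
  p * N + Real.sqrt (2 * N * p * (1 - p) * Real.log d) *
    (1 - Real.log (Real.log d) / (4 * Real.log d)
      - Real.log (2 * Real.sqrt Real.pi) / (2 * Real.log d))

/-- The scaling constant `b(d, N, p)`. -/
noncomputable def gumbelScale (d N : ℕ) (p : ℝ) : ℝ :=
  Real.sqrt (N * p * (1 - p) / (2 * Real.log d))

/-- The distribution function `x ↦ exp (-exp (-x))` of the standard Gumbel law. -/
noncomputable def gumbelCDF : StieltjesFunction ℝ where
  toFun x := Real.exp (-Real.exp (-x))
  mono' x y h := by
    apply Real.exp_le_exp.mpr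
    apply neg_le_neg
    exact Real.exp_le_exp.mpr (neg_le_neg h)
  right_continuous' x := by
    apply Continuous.continuousWithinAt
    fun_prop

/-- The standard Gumbel law. -/
noncomputable def gumbelMeasure : MeasureTheory.Measure ℝ := gumbelCDF.measure

theorem tendsto_gumbelCDF_atBot : Filter.Tendsto gumbelCDF Filter.atBot (nhds 0) := by
  change Filter.Tendsto (fun x : ℝ => Real.exp (-Real.exp (-x))) _ _
  exact Real.tendsto_exp_neg_atTop_nhds_zero.comp
    (Real.tendsto_exp_atTop.comp Filter.tendsto_neg_atBot_atTop)

theorem tendsto_gumbelCDF_atTop : Filter.Tendsto gumbelCDF Filter.atTop (nhds 1) := by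
  change Filter.Tendsto (fun x : ℝ => Real.exp (-Real.exp (-x))) _ _
  have h := (Real.continuous_exp.tendsto _).comp Real.tendsto_exp_neg_atTop_nhds_zero.neg
  simpa [Function.comp_def] using h

instance instIsProbabilityMeasureGumbelMeasure :
    MeasureTheory.IsProbabilityMeasure gumbelMeasure :=
  gumbelCDF.isProbabilityMeasure tendsto_gumbelCDF_atBot tendsto_gumbelCDF_atTop

theorem cdf_gumbelMeasure (x : ℝ) :
    ProbabilityTheory.cdf gumbelMeasure x = Real.exp (-Real.exp (-x)) := by
  unfold gumbelMeasure
  rw [ProbabilityTheory.cdf_measure_stieltjesFunction gumbelCDF tendsto_gumbelCDF_atBot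
    tendsto_gumbelCDF_atTop]
  rfl

/-! The maximum degree is at most `a_n + x b_n` exactly when no degree reaches m = ⌊a_n + x b_n⌋ +
1. A single degree is binomial with parameters N and p, and a_n, b_n are tuned so that the expected
number of exceedances, n P(Bin(N, p) ≥ m), tends to e^{-x}. It remains to see that the number of
exceedances is zero with nearly the Poisson probability.

Degrees are dependent, but exceedances are increasing events in independent edges. For such events
Harris' inequality alone bounds the distance of P(no exceedance) from its Poisson value by a sum of
squared probabilities plus a sum of covariances (`bernoulliSum.abs_prod_one_sub_sub_exp_le`). The
squares contribute O(1/n), so n² times a single covariance must be shown to vanish.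

Two degrees share Z edges, Z binomial, and are otherwise independent binomials with N' = C(n-2, k-1)
trials; given Z, the joint exceedance probability is a squared tail at m - Z. Binomial tails are
log-concave, so around the mean of Z they lie below an exponential, and the moment generating
function of Z bounds the joint probability by the squared tail at m - E Z times e^{o(1)}
(`sum_binomTerm_mul_sq_le`). Removing the shared edges changes the variance by a relative o(1/log
n), so that tail has the same asymptotics e^{-x}/n.

The one-degree asymptotics come from Stirling's formula and a discrete Mills ratio. With t the
deviation from the mean and v the variance, the local limit theorem requires t³/v² → 0; as t is of
order √(v log n), this is the condition log³ n = o(v). -/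

/-! ### Weak convergence from distribution functions -/

open MeasureTheory ProbabilityTheory Filter Topology in
-- Half-open intervals form a π-system containing small neighbourhoods of every point, and their
-- masses are differences of distribution functions.
theorem tendsto_probabilityMeasure_of_tendsto_cdf {ι : Type*} {l : Filter ι}
    [l.IsCountablyGenerated] {μ : ι → ProbabilityMeasure ℝ} {ν : ProbabilityMeasure ℝ}
    (h : ∀ x, Tendsto (fun i => (μ i : Measure ℝ).real (Set.Iic x)) l
      (𝓝 ((ν : Measure ℝ).real (Set.Iic x)))) : Tendsto μ l (𝓝 ν) := by
  have key (m : ProbabilityMeasure ℝ) {a b : ℝ} (hab : a ≤ b) :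
      ((m (Set.Ioc a b) : NNReal) : ℝ)
        = (m : Measure ℝ).real (Set.Iic b) - (m : Measure ℝ).real (Set.Iic a) := by
    rw [← measureReal_sdiff (Set.Iic_subset_Iic.2 hab) measurableSet_Iic, Set.Iic_sdiff_Iic]
    rfl
  refine IsPiSystem.tendsto_probabilityMeasure_of_tendsto_of_mem
    (isPiSystem_Ioc (id : ℝ → ℝ) (id : ℝ → ℝ)) ?_ ?_ ?_
  · rintro s ⟨a, b, -, rfl⟩
    exact measurableSet_Ioc
  · intro u hu x hx
    obtain ⟨ε, hε, hεu⟩ := Metric.isOpen_iff.1 hu x hx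
    refine ⟨Set.Ioc (x - ε / 2) (x + ε / 2), ⟨x - ε / 2, x + ε / 2, ?_, rfl⟩,
      Ioc_mem_nhds (by linarith) (by linarith), fun y hy => hεu ?_⟩
    · simp only [id]; linarith
    · rw [Metric.mem_ball, Real.dist_eq, abs_lt]
      constructor <;> linarith [hy.1, hy.2]
  · rintro s ⟨a, b, hab, rfl⟩
    rw [← NNReal.tendsto_coe]
    simp only [id] at *
    simp only [key _ hab.le]
    exact (h b).sub (h a)

/-! ### Expectations over random subsets and Harris' inequality -/

/-- The expectation of `F` of a random subset of `S` that contains each element of `S` with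
probability `p`, independently of the others. -/
def bernoulliSum {α : Type*} (p : ℝ) (S : Finset α) (F : Finset α → ℝ) : ℝ :=
  ∑ A ∈ S.powerset, p ^ A.card * (1 - p) ^ (S.card - A.card) * F A

namespace bernoulliSum

variable {α : Type*} {p : ℝ} {S T : Finset α} {F G : Finset α → ℝ}

theorem congr (h : ∀ A ⊆ S, F A = G A) : bernoulliSum p S F = bernoulliSum p S G := by
  unfold bernoulliSum
  exact Finset.sum_congr rfl fun A hA => by rw [h A (Finset.mem_powerset.1 hA)]

theorem mono (h0 : 0 ≤ p) (h1 : p ≤ 1) (h : ∀ A ⊆ S, F A ≤ G A) :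
    bernoulliSum p S F ≤ bernoulliSum p S G := by
  unfold bernoulliSum
  have : 0 ≤ 1 - p := by linarith
  exact Finset.sum_le_sum fun A hA =>
    mul_le_mul_of_nonneg_left (h A (Finset.mem_powerset.1 hA)) (by positivity)

theorem nonneg (h0 : 0 ≤ p) (h1 : p ≤ 1) (h : ∀ A ⊆ S, 0 ≤ F A) : 0 ≤ bernoulliSum p S F := by
  have := mono (S := S) (F := fun _ => 0) h0 h1 h
  simpa [bernoulliSum] using this

theorem add : bernoulliSum p S (fun A => F A + G A) = bernoulliSum p S F + bernoulliSum p S G := by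
  simp [bernoulliSum, mul_add, Finset.sum_add_distrib]

theorem sub : bernoulliSum p S (fun A => F A - G A) = bernoulliSum p S F - bernoulliSum p S G := by
  simp [bernoulliSum, mul_sub, Finset.sum_sub_distrib]

theorem const_mul (c : ℝ) : bernoulliSum p S (fun A => c * F A) = c * bernoulliSum p S F := by
  simp only [bernoulliSum, Finset.mul_sum]
  exact Finset.sum_congr rfl fun A _ => by ring

theorem mul_const (c : ℝ) : bernoulliSum p S (fun A => F A * c) = bernoulliSum p S F * c := by
  simp only [mul_comm _ c, const_mul]

theorem sum {ι : Type*} (V : Finset ι) (F : ι → Finset α → ℝ) :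
    bernoulliSum p S (fun A => ∑ i ∈ V, F i A) = ∑ i ∈ V, bernoulliSum p S (F i) := by
  simp only [bernoulliSum, Finset.mul_sum]
  exact Finset.sum_comm

theorem comp_card (g : ℕ → ℝ) : bernoulliSum p S (fun A => g A.card) =
    ∑ j ∈ Finset.range (S.card + 1),
      (S.card.choose j : ℝ) * p ^ j * (1 - p) ^ (S.card - j) * g j := by
  unfold bernoulliSum
  rw [Finset.sum_powerset_apply_card (fun j => p ^ j * (1 - p) ^ (S.card - j) * g j)]
  exact Finset.sum_congr rfl fun j _ => by rw [nsmul_eq_mul]; ring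

@[simp] theorem const (c : ℝ) : bernoulliSum p S (fun _ => c) = c := by
  rw [comp_card (fun _ => c), ← Finset.sum_mul]
  have h := add_pow p (1 - p) S.card
  rw [add_sub_cancel, one_pow] at h
  rw [Finset.sum_congr rfl fun j _ => (by ring : (S.card.choose j : ℝ) * p ^ j *
    (1 - p) ^ (S.card - j) = p ^ j * (1 - p) ^ (S.card - j) * (S.card.choose j : ℝ)), ← h, one_mul]

variable [DecidableEq α]

theorem insert {a : α} (ha : a ∉ S) : bernoulliSum p (insert a S) F =
    (1 - p) * bernoulliSum p S F + p * bernoulliSum p S (fun A => F (insert a A)) := by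
  unfold bernoulliSum
  rw [Finset.sum_powerset_insert ha, Finset.mul_sum, Finset.mul_sum]
  congr 1 <;> refine Finset.sum_congr rfl fun A hA => ?_
  · have hc := Finset.card_le_card (Finset.mem_powerset.1 hA)
    rw [Finset.card_insert_of_notMem ha, Nat.sub_add_comm hc, pow_succ]
    ring
  · have haA : a ∉ A := fun h => ha (Finset.mem_powerset.1 hA h)
    rw [Finset.card_insert_of_notMem ha, Finset.card_insert_of_notMem haA, Nat.add_sub_add_right,
      pow_succ]
    ring

/-- Independence over disjoint ground sets, obtained by conditioning on one element at a time. -/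
theorem union (h : Disjoint S T) : bernoulliSum p (S ∪ T) F =
    bernoulliSum p S fun A => bernoulliSum p T fun B => F (A ∪ B) := by
  induction S using Finset.induction_on generalizing F with
  | empty => simp [bernoulliSum]
  | insert a S ha ih =>
    rw [Finset.disjoint_insert_left] at h
    rw [Finset.insert_union, insert (by simp [ha, h.1]), insert ha, ih h.2, ih h.2]
    simp only [Finset.insert_union]

/-- Harris' inequality. -/
theorem harris [Fintype α] (h0 : 0 ≤ p) (h1 : p ≤ 1) (hF : Monotone F) (hG : Monotone G) :
    bernoulliSum p S F * bernoulliSum p S G ≤ bernoulliSum p S fun A => F A * G A := by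
  have h1' : 0 ≤ 1 - p := by linarith
  -- The product weight, extended by zero outside the subsets of S, satisfies the lattice condition
  -- of `fkg`, with equality for subsets of S because cardinality is modular.
  let μ : Finset α → ℝ := fun A => if A ⊆ S then p ^ A.card * (1 - p) ^ (S.card - A.card) else 0
  have hμ (H : Finset α → ℝ) : ∑ A, μ A * H A = bernoulliSum p S H := by
    simp only [μ, ite_mul, zero_mul, bernoulliSum, ← Finset.sum_filter]
    refine Finset.sum_congr ?_ fun _ _ => rfl
    ext A; simp
  have hμ1 : ∑ A, μ A = 1 := by simpa using hμ fun _ => 1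
  have hpos : 0 ≤ μ := fun A => by
    simp only [μ]; split_ifs <;> simp; positivity
  -- `fkg` asks for nonnegative functions; subtracting the minimum, attained at ∅, does not affect
  -- the covariance.
  have key := fkg (μ := μ) (f := fun A => F A - F ∅) (g := fun A => G A - G ∅) hpos
    (fun A => sub_nonneg.2 (hF (Finset.empty_subset A)))
    (fun A => sub_nonneg.2 (hG (Finset.empty_subset A)))
    (fun A B h => sub_le_sub_right (hF h) _) (fun A B h => sub_le_sub_right (hG h) _)
    (fun A B => by
      by_cases hA : A ⊆ S
      · by_cases hB : B ⊆ S
        · have e1 : A ⊓ B ⊆ S := Finset.inter_subset_left.trans hA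
          have e2 : A ⊔ B ⊆ S := Finset.union_subset hA hB
          have c := Finset.card_union_add_card_inter A B
          have cA := Finset.card_le_card hA
          have cB := Finset.card_le_card hB
          have c1 := Finset.card_le_card e1
          have c2 := Finset.card_le_card e2
          simp only [μ, hA, hB, e1, e2, if_true]
          rw [mul_mul_mul_comm, ← pow_add, ← pow_add, mul_mul_mul_comm, ← pow_add, ← pow_add]
          simp only [Finset.inf_eq_inter, Finset.sup_eq_union] at *
          rw [show A.card + B.card = (A ∩ B).card + (A ∪ B).card by omega,
            show S.card - A.card + (S.card - B.card)
              = S.card - (A ∩ B).card + (S.card - (A ∪ B).card) by omega]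
        · simp only [μ, hB, if_false, mul_zero]
          exact mul_nonneg (hpos _) (hpos _)
      · simp only [μ, hA, if_false, zero_mul]
        exact mul_nonneg (hpos _) (hpos _))
  rw [hμ1, one_mul, hμ, hμ, hμ] at key
  have e : bernoulliSum p S (fun A => (F A - F ∅) * (G A - G ∅)) =
      bernoulliSum p S (fun A => F A * G A) - G ∅ * bernoulliSum p S F
        - F ∅ * bernoulliSum p S G + F ∅ * G ∅ := by
    rw [bernoulliSum.congr (G := fun A => F A * G A - G ∅ * F A - F ∅ * G A + F ∅ * G ∅)
      fun A _ => by ring]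
    rw [add, sub, sub, const_mul, const_mul, const]
  rw [e, sub, sub, const, const] at key
  nlinarith [key]

end bernoulliSum

/-! ### Poisson approximation for increasing events -/

/-- On the unit cube, ∑ yᵢ + ∏ (1 - c yᵢ) is nondecreasing in each variable. Adding the sum thus
turns a decreasing product into an increasing function, to which Harris' inequality applies in the
opposite direction. -/
theorem prod_one_sub_mul_sub_le_sum {ι : Type*} (V : Finset ι) {c : ℝ} (hc0 : 0 ≤ c) (hc1 : c ≤ 1)
    {x y : ι → ℝ} (hx : ∀ i, 0 ≤ x i) (hxy : ∀ i, x i ≤ y i) (hy : ∀ i, y i ≤ 1) :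
    ∏ i ∈ V, (1 - c * x i) - ∏ i ∈ V, (1 - c * y i) ≤ ∑ i ∈ V, (y i - x i) := by
  classical
  induction V using Finset.induction_on with
  | empty => simp
  | insert a V ha ih =>
    rw [Finset.prod_insert ha, Finset.prod_insert ha, Finset.sum_insert ha]
    have hb0 : 0 ≤ ∏ i ∈ V, (1 - c * y i) := Finset.prod_nonneg fun i _ => by
      nlinarith [hx i, hxy i, hy i]
    have hb1 : ∏ i ∈ V, (1 - c * y i) ≤ 1 := Finset.prod_le_one
      (fun i _ => by nlinarith [hx i, hxy i, hy i]) fun i _ => by nlinarith [hx i, hxy i, hy i]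
    have hbb : ∏ i ∈ V, (1 - c * y i) ≤ ∏ i ∈ V, (1 - c * x i) := Finset.prod_le_prod
      (fun i _ => by nlinarith [hx i, hxy i, hy i])
      fun i _ => by nlinarith [hx i, hxy i, hy i]
    have h1 : 0 ≤ c * x a := mul_nonneg hc0 (hx a)
    have h2 : c * (y a - x a) ≤ y a - x a := by nlinarith [hxy a]
    have h3 : 0 ≤ c * (y a - x a) := mul_nonneg hc0 (by linarith [hxy a])
    nlinarith [mul_le_mul_of_nonneg_left hb1 h3, mul_nonneg h1 (sub_nonneg.2 hbb)]

namespace bernoulliSum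

variable {α ι : Type*} [DecidableEq α] [Fintype α] [DecidableEq ι] {p : ℝ} {S : Finset α}

/-- Poisson approximation for the number of increasing events that occur: the probability that none
occurs is compared with its Poisson counterpart through first and second moments only. -/
theorem abs_prod_one_sub_sub_exp_le (h0 : 0 ≤ p) (h1 : p ≤ 1) (V : Finset ι)
    (I : ι → Finset α → ℝ) (hI0 : ∀ i A, 0 ≤ I i A) (hI1 : ∀ i A, I i A ≤ 1)
    (hI : ∀ i, Monotone (I i)) :
    |bernoulliSum p S (fun A => ∏ i ∈ V, (1 - I i A)) -
        Real.exp (-∑ i ∈ V, bernoulliSum p S (I i))| ≤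
      ∑ i ∈ V, bernoulliSum p S (I i) ^ 2 + ∑ i ∈ V, ∑ j ∈ V.erase i,
        (bernoulliSum p S (fun A => I i A * I j A) -
          bernoulliSum p S (I i) * bernoulliSum p S (I j)) := by
  set E : (Finset α → ℝ) → ℝ := bernoulliSum p S with hE
  set m : ℝ := ∑ i ∈ V, E (I i) with hm
  set D2 : ℝ := ∑ i ∈ V, ∑ j ∈ V.erase i,
        (E (fun A => I i A * I j A) - E (I i) * E (I j)) with hD2
  set D1 : ℝ := ∑ i ∈ V, E (I i) ^ 2 with hD1
  have hD1' : 0 ≤ D1 := Finset.sum_nonneg fun i _ => sq_nonneg _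
  have hD2' : 0 ≤ D2 := Finset.sum_nonneg fun i _ => Finset.sum_nonneg fun j _ =>
    sub_nonneg.2 (harris h0 h1 (hI i) (hI j))
  have hEI (i) : 0 ≤ E (I i) := nonneg h0 h1 fun A _ => hI0 i A
  have hm0 : 0 ≤ m := Finset.sum_nonneg fun i _ => hEI i
  -- For indicators, `P u V` is u to the number of events that occur, so `φ` is the generating
  -- function of that number. A Poisson variable of mean m would satisfy φ' = mφ; the proof bounds
  -- the defect φ' - mφ uniformly on [0, 1].
  let P : ℝ → Finset ι → Finset α → ℝ := fun u W A => ∏ j ∈ W, (1 - (1 - u) * I j A)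
  let φ : ℝ → ℝ := fun u => E (P u V)
  let φ' : ℝ → ℝ := fun u => ∑ i ∈ V, E (fun A => I i A * P u (V.erase i) A)
  have hφ (u : ℝ) : HasDerivAt φ (φ' u) u := by
    have hP (A : Finset α) :
        HasDerivAt (fun u => P u V A) (∑ i ∈ V, I i A * P u (V.erase i) A) u := by
      have hi : ∀ i ∈ V, HasDerivAt (fun u : ℝ => 1 - (1 - u) * I i A) (I i A) u := fun i _ => by
        have := (((hasDerivAt_id u).const_sub 1).mul_const (I i A)).const_sub 1
        simpa using this
      have := HasDerivAt.fun_finsetProd hi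
      refine this.congr_deriv (Finset.sum_congr rfl fun i _ => ?_)
      rw [smul_eq_mul, mul_comm]
    have e : φ' u = E (fun A => ∑ i ∈ V, I i A * P u (V.erase i) A) := (bernoulliSum.sum V _).symm
    rw [e]
    simp only [φ, hE, bernoulliSum]
    exact HasDerivAt.fun_sum fun A _ => (hP A).const_mul _
  have hbound (u : ℝ) (hu0 : 0 ≤ u) (hu1 : u ≤ 1) : |φ' u - m * φ u| ≤ D1 + D2 := by
    have c0 : 0 ≤ 1 - u := by linarith
    have c1 : 1 - u ≤ 1 := by linarith
    have f0 (i A) : 0 ≤ 1 - (1 - u) * I i A := by nlinarith [hI0 i A, hI1 i A]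
    have f1 (i A) : 1 - (1 - u) * I i A ≤ 1 := by nlinarith [hI0 i A, hI1 i A]
    have P0 (W A) : 0 ≤ P u W A := Finset.prod_nonneg fun i _ => f0 i A
    have P1 (W A) : P u W A ≤ 1 := Finset.prod_le_one (fun i _ => f0 i A) fun i _ => f1 i A
    have Pins {i} (hi : i ∈ V) (A) : P u V A = (1 - (1 - u) * I i A) * P u (V.erase i) A :=
      (Finset.mul_prod_erase V (fun j => 1 - (1 - u) * I j A) hi).symm
    have Pup {i} (hi : i ∈ V) : E (P u V) ≤ E (P u (V.erase i)) := mono h0 h1 fun A _ => by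
      rw [Pins hi]
      nlinarith [P0 (V.erase i) A, f1 i A]
    have Plo {i} (hi : i ∈ V) : E (P u (V.erase i)) ≤ E (P u V) + E (I i) := by
      rw [hE, ← add]
      refine mono h0 h1 fun A _ => ?_
      rw [Pins hi]
      have := mul_le_mul_of_nonneg_left (P1 (V.erase i) A) (mul_nonneg c0 (hI0 i A))
      nlinarith [hI0 i A]
    have anti (W : Finset ι) : Monotone fun A => -P u W A := fun A B hAB => by
      refine neg_le_neg (Finset.prod_le_prod (fun i _ => f0 i B) fun i _ => ?_)
      nlinarith [hI i hAB]
    have incr (W : Finset ι) : Monotone fun A => ∑ j ∈ W, I j A + P u W A := fun A B hAB => by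
      have := prod_one_sub_mul_sub_le_sum W c0 c1 (fun i => hI0 i A) (fun i => hI i hAB)
        fun i => hI1 i B
      rw [Finset.sum_sub_distrib] at this
      simp only [P]
      linarith
    -- The product is decreasing, hence negatively correlated with `I i`; putting the factor i back
    -- costs at most `E (I i)`.
    have up {i} (hi : i ∈ V) :
        E (fun A => I i A * P u (V.erase i) A) - E (I i) * E (P u V) ≤ E (I i) ^ 2 := by
      have h := harris (S := S) h0 h1 (hI i) (anti (V.erase i))
      rw [congr (F := fun A => I i A * -P u (V.erase i) A)
        (G := fun A => (-1) * (I i A * P u (V.erase i) A)) fun A _ => by ring,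
        congr (F := fun A => -P u (V.erase i) A) (G := fun A => (-1) * P u (V.erase i) A)
        fun A _ => by ring, const_mul, const_mul] at h
      have := mul_le_mul_of_nonneg_left (Plo hi) (hEI i)
      simp only [← hE] at h
      nlinarith
    -- Harris' inequality for the compensated product: the negative correlation is at most the sum
    -- of the covariances with the other events.
    have lo {i} (hi : i ∈ V) :
        -(∑ j ∈ V.erase i, (E (fun A => I i A * I j A) - E (I i) * E (I j))) ≤
          E (fun A => I i A * P u (V.erase i) A) - E (I i) * E (P u V) := by
      have h := harris (S := S) h0 h1 (hI i) (incr (V.erase i))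
      rw [congr (F := fun A => I i A * (∑ j ∈ V.erase i, I j A + P u (V.erase i) A))
        (G := fun A => ∑ j ∈ V.erase i, I i A * I j A + I i A * P u (V.erase i) A)
        fun A _ => by rw [mul_add, Finset.mul_sum], add, add, bernoulliSum.sum, bernoulliSum.sum]
        at h
      have := mul_le_mul_of_nonneg_left (Pup hi) (hEI i)
      rw [Finset.sum_sub_distrib, ← Finset.mul_sum]
      simp only [← hE] at h
      linarith
    have e : φ' u - m * φ u =
        ∑ i ∈ V, (E (fun A => I i A * P u (V.erase i) A) - E (I i) * E (P u V)) := by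
      rw [Finset.sum_sub_distrib, ← Finset.sum_mul]
    rw [e, abs_le]
    constructor
    · have := Finset.sum_le_sum fun i (hi : i ∈ V) => lo hi
      rw [Finset.sum_neg_distrib] at this
      linarith
    · have := Finset.sum_le_sum fun i (hi : i ∈ V) => up hi
      linarith
  -- Integrating factor for φ' = mφ; comparing u = 0 with u = 1, where φ = 1, finishes the proof.
  have hψ (u : ℝ) : HasDerivAt (fun u => Real.exp (-(m * u)) * φ u)
      (Real.exp (-(m * u)) * (φ' u - m * φ u)) u := by
    have h := (((hasDerivAt_id u).const_mul m).fun_neg.exp).mul (hφ u)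
    refine h.congr_deriv ?_
    simp only [id]
    ring
  have mvt := norm_image_sub_le_of_norm_deriv_le_segment_01' (C := D1 + D2)
    (fun u _ => (hψ u).hasDerivWithinAt) fun u hu => by
      rw [Real.norm_eq_abs, abs_mul, abs_of_pos (Real.exp_pos _)]
      have e1 : Real.exp (-(m * u)) ≤ 1 := Real.exp_le_one_iff.2 (by nlinarith [hu.1])
      calc _ ≤ 1 * (D1 + D2) := mul_le_mul e1 (hbound u hu.1 hu.2.le) (abs_nonneg _) zero_le_one
        _ = _ := one_mul _
  have e1 : φ 1 = 1 := by simp [φ, P, hE]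
  have e0 : φ 0 = E fun A => ∏ i ∈ V, (1 - I i A) := by simp [φ, P]
  simp only [e1, e0, mul_one, mul_zero, neg_zero, Real.exp_zero, one_mul, Real.norm_eq_abs] at mvt
  rwa [abs_sub_comm]

end bernoulliSum

/-! ### Binomial masses and tails: log-concavity -/

/-- The probability that a binomial random variable with parameters `N` and `p` equals `j`. -/
def binomTerm (N : ℕ) (p : ℝ) (j : ℕ) : ℝ := (N.choose j : ℝ) * p ^ j * (1 - p) ^ (N - j)

/-- The probability that a binomial random variable with parameters `N` and `p` is at least `m`. -/
def binomTail (N : ℕ) (p : ℝ) (m : ℕ) : ℝ := ∑ j ∈ Finset.Ico m (N + 1), binomTerm N p j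

section binom

variable {N : ℕ} {p : ℝ}

theorem binomTerm_nonneg (h0 : 0 ≤ p) (h1 : p ≤ 1) (j : ℕ) : 0 ≤ binomTerm N p j := by
  have : 0 ≤ 1 - p := by linarith
  unfold binomTerm
  positivity

theorem binomTerm_pos (h0 : 0 < p) (h1 : p < 1) {j : ℕ} (hj : j ≤ N) : 0 < binomTerm N p j := by
  have : 0 < 1 - p := by linarith
  have : 0 < N.choose j := Nat.choose_pos hj
  unfold binomTerm
  positivity

theorem binomTerm_eq_zero {j : ℕ} (hj : N < j) : binomTerm N p j = 0 := by
  simp [binomTerm, Nat.choose_eq_zero_of_lt hj]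

theorem binomTail_eq_add (m : ℕ) : binomTail N p m = binomTerm N p m + binomTail N p (m + 1) := by
  unfold binomTail
  rcases le_or_gt m N with h | h
  · exact Finset.sum_eq_sum_Ico_succ_bot (by omega) _
  · rw [binomTerm_eq_zero h, Finset.Ico_eq_empty (by omega), Finset.Ico_eq_empty (by omega)]
    simp

theorem binomTail_nonneg (h0 : 0 ≤ p) (h1 : p ≤ 1) (m : ℕ) : 0 ≤ binomTail N p m :=
  Finset.sum_nonneg fun _ _ => binomTerm_nonneg h0 h1 _

theorem binomTail_pos (h0 : 0 < p) (h1 : p < 1) {m : ℕ} (hm : m ≤ N) : 0 < binomTail N p m := by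
  rw [binomTail_eq_add]
  exact add_pos_of_pos_of_nonneg (binomTerm_pos h0 h1 hm) (binomTail_nonneg h0.le h1.le _)

theorem binomTail_antitone (h0 : 0 ≤ p) (h1 : p ≤ 1) : Antitone (binomTail N p) :=
  antitone_nat_of_succ_le fun m => by
    rw [binomTail_eq_add m]
    linarith [binomTerm_nonneg (N := N) h0 h1 m]

/-- The truncated difference vanishes for j ≥ N, as does the mass at j + 1, so no range condition is
needed. -/
theorem binomTerm_succ_mul (j : ℕ) : binomTerm N p (j + 1) * ((j + 1) * (1 - p)) =
    binomTerm N p j * ((N - j : ℕ) * p) := by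
  rcases lt_or_ge j N with h | h
  · obtain ⟨d, rfl⟩ : ∃ d, N = j + 1 + d := ⟨N - (j + 1), by omega⟩
    have e := Nat.choose_succ_right_eq (j + 1 + d) j
    have e' : ((j + 1 + d).choose (j + 1) : ℝ) * (j + 1) =
      (j + 1 + d).choose j * ((j + 1 + d - j : ℕ) : ℝ) := by exact_mod_cast e
    unfold binomTerm
    rw [show j + 1 + d - (j + 1) = d by omega, show j + 1 + d - j = d + 1 by omega] at *
    rw [pow_succ, pow_succ]
    linear_combination (p ^ j * p * (1 - p) ^ d * (1 - p)) * e'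
  · rw [binomTerm_eq_zero (by omega), Nat.sub_eq_zero_of_le h]
    simp

theorem binomTerm_mul_le (h0 : 0 < p) (h1 : p < 1) {i j : ℕ} (hij : i ≤ j) :
    binomTerm N p i * binomTerm N p (j + 1) ≤ binomTerm N p (i + 1) * binomTerm N p j := by
  have hi := binomTerm_succ_mul (N := N) (p := p) i
  have hj := binomTerm_succ_mul (N := N) (p := p) j
  have hq : 0 < 1 - p := by linarith
  have bi := binomTerm_nonneg (N := N) h0.le h1.le i
  have bj := binomTerm_nonneg (N := N) h0.le h1.le j
  have hc : ((N - j : ℕ) : ℝ) ≤ (N - i : ℕ) := by exact_mod_cast Nat.sub_le_sub_left hij N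
  have hc' : (i : ℝ) + 1 ≤ j + 1 := by exact_mod_cast Nat.succ_le_succ hij
  have hi0 : (0 : ℝ) < i + 1 := by positivity
  have hj0 : (0 : ℝ) < j + 1 := by positivity
  have hle : (N - j : ℕ) * ((i : ℝ) + 1) ≤ (N - i : ℕ) * ((j : ℝ) + 1) :=
    mul_le_mul hc hc' hi0.le (by positivity)
  refine le_of_mul_le_mul_right ?_ (by positivity : 0 < ((i + 1) * (1 - p)) * ((j + 1) * (1 - p)))
  calc binomTerm N p i * binomTerm N p (j + 1) * (((i + 1) * (1 - p)) * ((j + 1) * (1 - p)))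
      = binomTerm N p i * binomTerm N p j * (p * (1 - p)) * ((N - j : ℕ) * ((i : ℝ) + 1)) := by
        linear_combination (binomTerm N p i * ((i + 1) * (1 - p))) * hj
    _ ≤ binomTerm N p i * binomTerm N p j * (p * (1 - p)) * ((N - i : ℕ) * ((j : ℝ) + 1)) :=
        mul_le_mul_of_nonneg_left hle (by positivity)
    _ = _ := by linear_combination (-(binomTerm N p j * ((j + 1) * (1 - p)))) * hi

/-- Log-concavity passes from masses to tails by comparing the sums termwise after a shift of the
index by one; the unmatched last term has the right sign. -/
theorem binomTail_mul_le (h0 : 0 < p) (h1 : p < 1) (y : ℕ) :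
    binomTail N p y * binomTail N p (y + 2) ≤ binomTail N p (y + 1) ^ 2 := by
  have key : binomTerm N p y * binomTail N p (y + 2) ≤
      binomTerm N p (y + 1) * binomTail N p (y + 1) := by
    unfold binomTail
    rcases le_or_gt N y with h | h
    · rw [Finset.Ico_eq_empty (by omega)]
      rw [Finset.sum_empty, mul_zero]
      exact mul_nonneg (binomTerm_nonneg h0.le h1.le _)
        (Finset.sum_nonneg fun _ _ => binomTerm_nonneg h0.le h1.le _)
    · have e : ∑ j ∈ Finset.Ico (y + 1) (N + 1), binomTerm N p j =
          binomTerm N p N + ∑ j ∈ Finset.Ico (y + 1) N, binomTerm N p j := by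
        rw [Finset.sum_Ico_succ_top (by omega), add_comm]
      rw [e, mul_add, ← Finset.sum_Ico_add' _ (y + 1) N 1, Finset.mul_sum, Finset.mul_sum]
      refine le_add_of_nonneg_of_le
        (mul_nonneg (binomTerm_nonneg h0.le h1.le _) (binomTerm_nonneg h0.le h1.le _)) ?_
      refine Finset.sum_le_sum fun j hj => binomTerm_mul_le h0 h1 ?_
      have := (Finset.mem_Ico.1 hj).1
      omega
  rw [binomTail_eq_add y]
  have e := binomTail_eq_add (N := N) (p := p) (y + 1)
  rw [add_assoc, one_add_one_eq_two] at e
  linear_combination key - binomTail N p (y + 1) * e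

end binom

/-! ### Second moments of log-concave tails -/

/-- A log-concave sequence lies below its geometric interpolation. -/
theorem mul_pow_le_mul_pow_of_logConcave {f : ℕ → ℝ} (hlc : ∀ y, f y * f (y + 2) ≤ f (y + 1) ^ 2)
    (hf : ∀ y, 0 ≤ f y) (hanti : Antitone f) {a : ℕ} {R : ℝ} (ha : f a = f (a + 1) * R)
    (hpos : 0 < f (a + 1)) (z₀ z : ℕ) :
    f (z₀ + (a + 1) - z) * R ^ z₀ ≤ f (a + 1) * R ^ z := by
  have hR : 1 ≤ R := by
    have := hanti (Nat.le_succ a)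
    rw [ha] at this
    nlinarith
  have hR0 : 0 < R := by linarith
  -- The ratio of consecutive values is R at a, at least R beyond a and at most R before a.
  have up (j : ℕ) : f (a + j + 1) * R ≤ f (a + j) := by
    induction j with
    | zero => exact ha.ge
    | succ j ih =>
      rw [show a + (j + 1) + 1 = a + j + 2 by ring, show a + (j + 1) = a + j + 1 by ring]
      rcases (hf (a + j + 1)).eq_or_lt with h | h
      · have h2 : f (a + j + 2) = 0 := le_antisymm (h ▸ hanti (Nat.le_succ _)) (hf _)
        rw [h2, zero_mul]
        exact hf _
      · refine le_of_mul_le_mul_left ?_ h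
        nlinarith [hf (a + j + 2), hlc (a + j)]
  have down (j : ℕ) : ∀ y, y + j = a → f y ≤ f (y + 1) * R := by
    induction j with
    | zero => rintro y rfl; exact ha.le
    | succ j ih =>
      intro y hy
      have h := ih (y + 1) (by omega)
      have h2 : 0 < f (y + 2) := hpos.trans_le (hanti (by omega))
      refine le_of_mul_le_mul_right ?_ h2
      nlinarith [hlc y, hf (y + 1)]
  have up' (j : ℕ) : f (a + 1 + j) * R ^ j ≤ f (a + 1) := by
    induction j with
    | zero => simp
    | succ j ih =>
      have h := up (j + 1)
      rw [show a + (j + 1) + 1 = a + 1 + (j + 1) by ring, show a + (j + 1) = a + 1 + j by ring] at h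
      calc f (a + 1 + (j + 1)) * R ^ (j + 1) = f (a + 1 + (j + 1)) * R * R ^ j := by ring
        _ ≤ f (a + 1 + j) * R ^ j := mul_le_mul_of_nonneg_right h (by positivity)
        _ ≤ _ := ih
  have down' (j : ℕ) : ∀ y, y + j = a + 1 → f y ≤ f (a + 1) * R ^ j := by
    induction j with
    | zero => rintro y rfl; simp
    | succ j ih =>
      intro y hy
      calc f y ≤ f (y + 1) * R := down j y (by omega)
        _ ≤ f (a + 1) * R ^ j * R := mul_le_mul_of_nonneg_right (ih _ (by omega)) hR0.le
        _ = _ := by ring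
  rcases le_total z z₀ with h | h
  · obtain ⟨j, rfl⟩ := Nat.exists_eq_add_of_le h
    rw [show z + j + (a + 1) - z = a + 1 + j by omega, pow_add, mul_comm (R ^ z), ← mul_assoc]
    exact mul_le_mul_of_nonneg_right (up' j) (by positivity)
  · obtain ⟨j, rfl⟩ := Nat.exists_eq_add_of_le h
    rw [pow_add, mul_comm (R ^ z₀), ← mul_assoc]
    refine mul_le_mul_of_nonneg_right ?_ (by positivity)
    rcases le_total j (a + 1) with hj | hj
    · exact down' j _ (by omega)
    -- Here the truncated subtraction stops at index 0, and R ≥ 1 absorbs the excess in the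
    -- exponent.
    · rw [show z₀ + (a + 1) - (z₀ + j) = 0 by omega]
      exact (down' (a + 1) 0 (by omega)).trans
        (mul_le_mul_of_nonneg_left (pow_le_pow_right₀ hR hj) hpos.le)

/-- Second moment of a shifted log-concave tail over a binomial shift. -/
theorem sum_binomTerm_mul_sq_le {f : ℕ → ℝ} (hlc : ∀ y, f y * f (y + 2) ≤ f (y + 1) ^ 2)
    (hf : ∀ y, 0 ≤ f y) (hanti : Antitone f) {a : ℕ} {s : ℝ} (ha : f a = f (a + 1) * Real.exp s)
    (hpos : 0 < f (a + 1)) (hs0 : 0 ≤ s) (hs1 : s ≤ 1 / 2) {M : ℕ} {p : ℝ} (h0 : 0 ≤ p)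
    (h1 : p ≤ 1) {z₀ : ℕ} (hz₀ : p * M ≤ z₀ + 1) :
    ∑ z ∈ Finset.range (M + 1), binomTerm M p z * f (z₀ + (a + 1) - z) ^ 2 ≤
      f (a + 1) ^ 2 * Real.exp (2 * s + 4 * s ^ 2 * (M * p * (1 - p))) := by
  have hq : 0 ≤ 1 - p := by linarith
  set R := Real.exp s with hR
  have hR0 : 0 < R := Real.exp_pos s
  have hterm (z : ℕ) : f (z₀ + (a + 1) - z) ^ 2 * R ^ (2 * z₀) ≤ f (a + 1) ^ 2 * (R ^ 2) ^ z := by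
    have h := mul_pow_le_mul_pow_of_logConcave hlc hf hanti ha hpos z₀ z
    have h' := pow_le_pow_left₀ (mul_nonneg (hf _) (by positivity)) h 2
    calc _ = (f (z₀ + (a + 1) - z) * R ^ z₀) ^ 2 := by ring
      _ ≤ _ := h'
      _ = _ := by ring
  have hmgf : ∑ z ∈ Finset.range (M + 1), binomTerm M p z * (R ^ 2) ^ z =
      (p * R ^ 2 + (1 - p)) ^ M := by
    rw [add_pow]
    exact Finset.sum_congr rfl fun z _ => by rw [binomTerm, mul_pow]; ring
  have hsum : (∑ z ∈ Finset.range (M + 1), binomTerm M p z * f (z₀ + (a + 1) - z) ^ 2) *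
      R ^ (2 * z₀) ≤ f (a + 1) ^ 2 * (p * R ^ 2 + (1 - p)) ^ M := by
    rw [← hmgf, Finset.sum_mul, Finset.mul_sum]
    refine Finset.sum_le_sum fun z _ => ?_
    calc _ = binomTerm M p z * (f (z₀ + (a + 1) - z) ^ 2 * R ^ (2 * z₀)) := by ring
      _ ≤ binomTerm M p z * (f (a + 1) ^ 2 * (R ^ 2) ^ z) :=
        mul_le_mul_of_nonneg_left (hterm z) (binomTerm_nonneg h0 h1 z)
      _ = _ := by ring
  -- One centred Bernoulli factor. The bound e^x ≤ 1 + x + x² for |x| ≤ 1 is where s ≤ 1/2 enters;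
  -- centring cancels the linear terms.
  have hone : (p * R ^ 2 + (1 - p)) * Real.exp (-(2 * s * p)) ≤
      Real.exp (4 * s ^ 2 * (p * (1 - p))) := by
    have e1 : p * R ^ 2 * Real.exp (-(2 * s * p)) = p * Real.exp (2 * s * (1 - p)) := by
      rw [hR, ← Real.exp_nat_mul, mul_assoc, ← Real.exp_add]
      congr 2
      push_cast
      ring
    have b1 := abs_le.1 (Real.abs_exp_sub_one_sub_id_le (x := 2 * s * (1 - p))
      (by rw [abs_le]; constructor <;> nlinarith))
    have b2 := abs_le.1 (Real.abs_exp_sub_one_sub_id_le (x := -(2 * s * p))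
      (by rw [abs_le]; constructor <;> nlinarith))
    calc _ = p * Real.exp (2 * s * (1 - p)) + (1 - p) * Real.exp (-(2 * s * p)) := by
          rw [add_mul, e1]
      _ ≤ p * (1 + 2 * s * (1 - p) + (2 * s * (1 - p)) ^ 2) +
          (1 - p) * (1 + -(2 * s * p) + (-(2 * s * p)) ^ 2) :=
        add_le_add (mul_le_mul_of_nonneg_left (by linarith [b1.2]) h0)
          (mul_le_mul_of_nonneg_left (by linarith [b2.2]) hq)
      _ = 4 * s ^ 2 * (p * (1 - p)) + 1 := by ring
      _ ≤ _ := Real.add_one_le_exp _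
  have hM : (p * R ^ 2 + (1 - p)) ^ M * Real.exp (-(2 * s * (p * M))) ≤
      Real.exp (4 * s ^ 2 * (M * p * (1 - p))) := by
    have h := pow_le_pow_left₀ (by positivity) hone M
    rw [mul_pow, ← Real.exp_nat_mul (-(2 * s * p)),
      ← Real.exp_nat_mul (4 * s ^ 2 * (p * (1 - p)))] at h
    rwa [show (M : ℝ) * -(2 * s * p) = -(2 * s * (p * M)) by ring,
      show (M : ℝ) * (4 * s ^ 2 * (p * (1 - p))) = 4 * s ^ 2 * (M * p * (1 - p)) by ring] at h
  -- Replacing the mean pM by the integer z₀ costs the factor e^{2s}.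
  have hRz : Real.exp (2 * s * (p * M)) ≤ Real.exp (2 * s) * R ^ (2 * z₀) := by
    rw [hR, ← Real.exp_nat_mul, ← Real.exp_add]
    refine Real.exp_le_exp.2 ?_
    push_cast
    nlinarith
  rw [Real.exp_add]
  refine le_of_mul_le_mul_right ?_ (by positivity : 0 < R ^ (2 * z₀))
  refine hsum.trans ?_
  have hE : (p * R ^ 2 + (1 - p)) ^ M =
      (p * R ^ 2 + (1 - p)) ^ M * Real.exp (-(2 * s * (p * M))) * Real.exp (2 * s * (p * M)) := by
    rw [mul_assoc, ← Real.exp_add]; simp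
  rw [hE]
  calc _ ≤ f (a + 1) ^ 2 * (Real.exp (4 * s ^ 2 * (M * p * (1 - p))) *
        (Real.exp (2 * s) * R ^ (2 * z₀))) :=
        mul_le_mul_of_nonneg_left (mul_le_mul hM hRz (by positivity) (by positivity)) (by positivity)
    _ = _ := by ring

/-! ### One and two degrees as binomial counts -/

namespace bernoulliSum

variable {α : Type*} {p : ℝ} {S : Finset α}

theorem comp_filter [DecidableEq α] (P : α → Prop) [DecidablePred P] (F : Finset α → ℝ) :
    bernoulliSum p S (fun A => F (A.filter P)) = bernoulliSum p (S.filter P) F := by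
  rw [← Finset.filter_union_filter_not_eq P S, union (Finset.disjoint_filter_filter_not _ _ _)]
  rw [Finset.filter_union_filter_not_eq P S]
  refine congr fun A hA => ?_
  rw [congr (G := fun _ => F A), const]
  intro B hB
  congr 1
  ext x
  simp only [Finset.mem_filter, Finset.mem_union]
  constructor
  · rintro ⟨h | h, hx⟩
    · exact h
    · exact absurd hx (Finset.mem_filter.1 (hB h)).2
  · intro h
    exact ⟨Or.inl h, (Finset.mem_filter.1 (hA h)).2⟩

theorem le_card (a m : ℕ) : bernoulliSum p S (fun A => if m ≤ a + A.card then 1 else 0) =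
    binomTail S.card p (m - a) := by
  rw [comp_card fun j => if m ≤ a + j then (1 : ℝ) else 0]
  simp only [mul_ite, mul_one, mul_zero, ← Finset.sum_filter]
  unfold binomTail binomTerm
  refine Finset.sum_congr ?_ fun _ _ => rfl
  ext j
  simp only [Finset.mem_filter, Finset.mem_range, Finset.mem_Ico]
  omega

theorem le_card_filter [DecidableEq α] (P : α → Prop) [DecidablePred P] (m : ℕ) :
    bernoulliSum p S (fun A => if m ≤ (A.filter P).card then 1 else 0) =
      binomTail (S.filter P).card p m := by
  rw [comp_filter P fun A => if m ≤ A.card then 1 else 0]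
  simpa using le_card (p := p) (S := S.filter P) 0 m

/-- Split the ground set into the elements common to P and Q and those private to each. Given z
common elements, the two private counts are independent and must each reach m - z; truncation is
harmless because the tail at 0 is 1. -/
theorem le_card_filter_mul [DecidableEq α] (P Q : α → Prop) [DecidablePred P] [DecidablePred Q] {m N : ℕ}
    (hP : (S.filter fun x => P x ∧ ¬Q x).card = N) (hQ : (S.filter fun x => Q x ∧ ¬P x).card = N) :
    bernoulliSum p S (fun A => (if m ≤ (A.filter P).card then 1 else 0) *
        if m ≤ (A.filter Q).card then 1 else 0) =
      ∑ z ∈ Finset.range ((S.filter fun x => P x ∧ Q x).card + 1),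
        binomTerm (S.filter fun x => P x ∧ Q x).card p z * binomTail N p (m - z) ^ 2 := by
  set Z := S.filter fun x => P x ∧ Q x with hZ
  set U := S.filter fun x => P x ∧ ¬Q x with hU
  set V := S.filter fun x => Q x ∧ ¬P x with hV
  have hS : S.filter (fun x => P x ∨ Q x) = Z ∪ (U ∪ V) := by
    ext x
    simp only [hZ, hU, hV, Finset.mem_filter, Finset.mem_union]
    tauto
  have d1 : Disjoint U V := by
    rw [Finset.disjoint_left]
    intro x hx hx'
    exact (Finset.mem_filter.1 hx).2.2 (Finset.mem_filter.1 hx').2.1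
  have d2 : Disjoint Z (U ∪ V) := by
    rw [Finset.disjoint_left]
    intro x hx hx'
    have hx := (Finset.mem_filter.1 hx).2
    rcases Finset.mem_union.1 hx' with h | h
    · exact (Finset.mem_filter.1 h).2.2 hx.2
    · exact (Finset.mem_filter.1 h).2.2 hx.1
  have e (A : Finset α) : ((if m ≤ (A.filter P).card then 1 else 0) *
      if m ≤ (A.filter Q).card then 1 else 0 : ℝ) =
      (fun A : Finset α => ((if m ≤ (A.filter P).card then 1 else 0) *
      if m ≤ (A.filter Q).card then 1 else 0 : ℝ)) (A.filter fun x => P x ∨ Q x) := by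
    simp only [Finset.filter_filter]
    congr 4 <;>
    · ext x
      simp only [Finset.mem_filter]
      tauto
  rw [congr fun A _ => e A, comp_filter (fun x => P x ∨ Q x)
    (fun A : Finset α => ((if m ≤ (A.filter P).card then 1 else 0) *
      if m ≤ (A.filter Q).card then 1 else 0 : ℝ)), hS, union d2]
  have inner (A : Finset α) (hA : A ⊆ Z) :
      bernoulliSum p (U ∪ V) (fun B => (if m ≤ ((A ∪ B).filter P).card then 1 else 0) *
        if m ≤ ((A ∪ B).filter Q).card then 1 else 0 : Finset α → ℝ) =
      (fun z => binomTail N p (m - z) ^ 2) A.card := by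
    rw [union d1]
    have hc (B C : Finset α) (hB : B ⊆ U) (hC : C ⊆ V) :
        ((A ∪ (B ∪ C)).filter P).card = A.card + B.card ∧
        ((A ∪ (B ∪ C)).filter Q).card = A.card + C.card := by
      have hA' := fun x (hx : x ∈ A) => (Finset.mem_filter.1 (hA hx)).2
      have hB' := fun x (hx : x ∈ B) => (Finset.mem_filter.1 (hB hx)).2
      have hC' := fun x (hx : x ∈ C) => (Finset.mem_filter.1 (hC hx)).2
      constructor
      · rw [← Finset.card_union_of_disjoint (Finset.disjoint_left.2 fun x h h' =>
          (hB' x h').2 (hA' x h).2)]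
        congr 1
        ext x
        have := hA' x; have := hB' x; have := hC' x
        simp only [Finset.mem_filter, Finset.mem_union]
        tauto
      · rw [← Finset.card_union_of_disjoint (Finset.disjoint_left.2 fun x h h' =>
          (hC' x h').2 (hA' x h).1)]
        congr 1
        ext x
        have := hA' x; have := hB' x; have := hC' x
        simp only [Finset.mem_filter, Finset.mem_union]
        tauto
    have step (B : Finset α) (hB : B ⊆ U) :
        bernoulliSum p V (fun C => (if m ≤ ((A ∪ (B ∪ C)).filter P).card then 1 else 0) *
          if m ≤ ((A ∪ (B ∪ C)).filter Q).card then 1 else 0 : Finset α → ℝ) =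
        (if m ≤ A.card + B.card then 1 else 0) * binomTail N p (m - A.card) := by
      rw [congr (G := fun C => (if m ≤ A.card + B.card then 1 else 0) *
        if m ≤ A.card + C.card then 1 else 0) fun C hC => by
          rw [(hc B C hB hC).1, (hc B C hB hC).2], const_mul, le_card, hQ]
    rw [congr step, mul_const, le_card, hP]
    ring
  rw [congr inner, comp_card fun z => binomTail N p (m - z) ^ 2]
  rfl

end bernoulliSum

/-! ### The random hypergraph -/

section law

open MeasureTheory ProbabilityTheory

theorem setBernoulli_real_eq_bernoulliSum {α : Type*} [Finite α] [DecidableEq α] (S : Finset α)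
    (p : unitInterval) (T : Set (Set α)) [DecidablePred fun A : Finset α => (A : Set α) ∈ T] :
    (setBernoulli (S : Set α) p).real T =
      bernoulliSum (p : ℝ) S fun A => if (A : Set α) ∈ T then 1 else 0 := by
  have hT : {s ∈ T | s ⊆ (S : Set α)} =
      ⋃ A ∈ S.powerset.filter (fun A : Finset α => (A : Set α) ∈ T), {(A : Set α)} := by
    ext s
    simp only [Set.mem_ofPred_eq, Set.mem_iUnion, Finset.mem_filter, Finset.mem_powerset,
      Set.mem_singleton_iff, exists_prop]
    constructor
    · rintro ⟨h1, h2⟩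
      refine ⟨(Set.toFinite s).toFinset, ⟨?_, ?_⟩, ?_⟩ <;> simp [h1]
      exact h2
    · rintro ⟨A, ⟨h1, h2⟩, rfl⟩
      exact ⟨h2, by exact_mod_cast h1⟩
  rw [measureReal_def, setBernoulli_apply_eq_apply_subsets, hT, ← measureReal_def,
    measureReal_biUnion_finset]
  · simp only [bernoulliSum, mul_ite, mul_one, mul_zero, ← Finset.sum_filter]
    refine Finset.sum_congr rfl fun A hA => ?_
    have hA' : A ⊆ S := (by simpa using hA : A ⊆ S ∧ _).1
    rw [setBernoulli_real_singleton p (by exact_mod_cast hA') S.finite_toSet,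
      Set.ncard_coe_finset, ← Finset.coe_sdiff, Set.ncard_coe_finset,
      Finset.card_sdiff_of_subset hA']
  · intro A _ B _ hAB
    simpa [Function.onFun] using hAB
  · exact fun A _ => measurableSet_singleton _

variable {n k m : ℕ} {p : unitInterval}

theorem hyperDegree_coe (A : Finset (Finset (Fin n))) (i : Fin n) :
    hyperDegree (A : Set (Finset (Fin n))) i = (A.filter fun e => i ∈ e).card := by
  rw [hyperDegree, ← Set.ncard_coe_finset]
  congr 1
  ext e
  simp

/-- The product is the indicator that no degree reaches m. Positivity of m is needed for an empty
vertex set, where the supremum is 0. -/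
theorem binomialHypergraph_real_maxHyperDegree_lt (hm : 0 < m) :
    (binomialHypergraph n k p).real {H | maxHyperDegree H < m} =
      bernoulliSum (p : ℝ) (Finset.powersetCard k Finset.univ) fun A =>
        ∏ i : Fin n, (1 - if m ≤ (A.filter fun e => i ∈ e).card then 1 else 0) := by
  classical
  have hS : kSubsets n k = (Finset.powersetCard k (Finset.univ : Finset (Fin n)) : Set _) := by
    ext e; simp [kSubsets]
  rw [binomialHypergraph, hS, setBernoulli_real_eq_bernoulliSum]
  refine bernoulliSum.congr fun A _ => ?_
  simp only [Set.mem_ofPred_eq, maxHyperDegree, hyperDegree_coe, Finset.sup_lt_iff hm,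
    Finset.mem_univ, true_implies]
  split_ifs with h
  · exact (Finset.prod_eq_one fun i _ => by simp [h i]).symm
  · push Not at h
    obtain ⟨i, hi⟩ := h
    exact (Finset.prod_eq_zero (Finset.mem_univ i) (by simp [hi])).symm

theorem card_powersetCard_filter_mem {α : Type*} [DecidableEq α] {T : Finset α} {i : α}
    (hi : i ∈ T) {k : ℕ} (hk : 1 ≤ k) :
    ((T.powersetCard k).filter fun e => i ∈ e).card = (T.card - 1).choose (k - 1) := by
  obtain ⟨k, rfl⟩ := Nat.exists_eq_add_of_le' hk
  have hT : T.card = (T.erase i).card + 1 := (Finset.card_erase_add_one hi).symm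
  have h := Finset.card_filter_add_card_filter_not (s := T.powersetCard (k + 1)) (fun e => i ∈ e)
  have h' : (T.powersetCard (k + 1)).filter (fun e => i ∉ e) = (T.erase i).powersetCard (k + 1) := by
    ext e
    simp only [Finset.mem_filter, Finset.mem_powersetCard, Finset.subset_erase]
    tauto
  rw [h', Finset.card_powersetCard, Finset.card_powersetCard, hT, Nat.choose_succ_succ'] at h
  rw [hT]
  simp only [Nat.add_sub_cancel]
  omega

theorem card_powersetCard_filter_mem_and_notMem {α : Type*} [DecidableEq α] {T : Finset α}
    {i j : α} (hi : i ∈ T) (hj : j ∈ T) (hij : i ≠ j) {k : ℕ} (hk : 1 ≤ k) :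
    ((T.powersetCard k).filter fun e => i ∈ e ∧ j ∉ e).card = (T.card - 2).choose (k - 1) := by
  have h := card_powersetCard_filter_mem (Finset.mem_erase.2 ⟨hij, hi⟩) hk
  rw [Finset.card_erase_of_mem hj, Nat.sub_sub] at h
  rw [← h]
  congr 1
  ext e
  simp only [Finset.mem_filter, Finset.mem_powersetCard, Finset.subset_erase]
  tauto

/-- Poisson approximation for the event that all degrees are small. -/
theorem abs_binomialHypergraph_real_maxHyperDegree_lt_sub_exp_le (hm : 0 < m) (hk : 1 ≤ k)
    {N N' : ℕ} {δ : ℝ} (hδ0 : 0 ≤ δ) (hN : (n - 1).choose (k - 1) = N) (hN' : (n - 2).choose (k - 1) = N')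
    (hδ : ∑ z ∈ Finset.range (N - N' + 1), binomTerm (N - N') p z * binomTail N' p (m - z) ^ 2 ≤
      binomTail N p m ^ 2 + δ) :
    |(binomialHypergraph n k p).real {H | maxHyperDegree H < m} -
        Real.exp (-(n * binomTail N p m))| ≤
      n * binomTail N p m ^ 2 + n ^ 2 * δ := by
  have h0 : (0 : ℝ) ≤ p := p.2.1
  have h1 : (p : ℝ) ≤ 1 := p.2.2
  rw [binomialHypergraph_real_maxHyperDegree_lt hm]
  set S := Finset.powersetCard k (Finset.univ : Finset (Fin n))
  have hcard (i : Fin n) : (S.filter fun e => i ∈ e).card = N := by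
    rw [card_powersetCard_filter_mem (Finset.mem_univ i) hk, Finset.card_univ, Fintype.card_fin, hN]
  have hcard' {i j : Fin n} (hij : i ≠ j) : (S.filter fun e => i ∈ e ∧ j ∉ e).card = N' := by
    rw [card_powersetCard_filter_mem_and_notMem (Finset.mem_univ i) (Finset.mem_univ j) hij hk,
      Finset.card_univ, Fintype.card_fin, hN']
  have hcard2 {i j : Fin n} (hij : i ≠ j) :
      (S.filter fun e => i ∈ e ∧ j ∈ e).card = N - N' := by
    have h := Finset.card_filter_add_card_filter_not (s := S.filter fun e => i ∈ e) (fun e => j ∈ e)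
    rw [Finset.filter_filter, Finset.filter_filter, hcard' hij, hcard] at h
    omega
  let I : Fin n → Finset (Finset (Fin n)) → ℝ := fun i A =>
    if m ≤ (A.filter fun e => i ∈ e).card then 1 else 0
  have hEI (i) : bernoulliSum (p : ℝ) S (I i) = binomTail N p m := by
    rw [← hcard i]
    exact bernoulliSum.le_card_filter _ _
  have hEII {i j} (hij : i ≠ j) : bernoulliSum (p : ℝ) S (fun A => I i A * I j A) =
      ∑ z ∈ Finset.range (N - N' + 1), binomTerm (N - N') p z * binomTail N' p (m - z) ^ 2 := by
    rw [← hcard2 hij]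
    exact bernoulliSum.le_card_filter_mul _ _ (hcard' hij) (hcard' hij.symm)
  have hI : ∀ i, Monotone (I i) := fun i A B hAB => by
    have := Finset.card_le_card (Finset.filter_subset_filter (fun e => i ∈ e) hAB)
    simp only [I]
    split_ifs with h h' <;> first | exact absurd (h.trans this) h' | norm_num
  have key := bernoulliSum.abs_prod_one_sub_sub_exp_le (S := S) h0 h1 Finset.univ I
    (fun i A => by simp only [I]; split_ifs <;> norm_num)
    (fun i A => by simp only [I]; split_ifs <;> norm_num) hI
  simp only [hEI, Finset.sum_const, Finset.card_univ, Fintype.card_fin, nsmul_eq_mul] at key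
  refine key.trans (add_le_add le_rfl ?_)
  -- Each covariance is at most δ; enlarging the sum to all n² pairs is allowed since δ ≥ 0.
  calc _ ≤ ∑ _i : Fin n, ∑ _j : Fin n, δ := by
        refine Finset.sum_le_sum fun i _ => ?_
        refine (Finset.sum_le_sum fun j hj => ?_).trans
          (Finset.sum_le_sum_of_subset_of_nonneg (Finset.erase_subset i _) fun _ _ _ => hδ0)
        rw [hEII (Finset.ne_of_mem_erase hj).symm, ← sq]
        linarith
    _ = _ := by simp; ring

end law

/-! ### Discrete Mills ratio -/

section tailBounds

variable {N : ℕ} {p : ℝ}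

theorem sum_Ico_sub_succ {a b : ℕ} (h : a ≤ b) (G : ℕ → ℝ) :
    ∑ j ∈ Finset.Ico a b, (G j - G (j + 1)) = G a - G b := by
  have := Finset.sum_Ico_sub G h
  rw [Finset.sum_sub_distrib] at *
  linarith

/-- Discrete counterpart of xφ(x) = -φ'(x) for the Gaussian density: it makes truncated moments
telescope. -/
theorem mul_binomTerm_sub_succ {j : ℕ} (hj : j ≤ N) :
    j * (1 - p) * binomTerm N p j - (j + 1 : ℕ) * (1 - p) * binomTerm N p (j + 1) =
      (j - N * p) * binomTerm N p j := by
  have h := binomTerm_succ_mul (N := N) (p := p) j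
  rw [Nat.cast_sub hj] at h
  push_cast
  linear_combination -h

/-- De Moivre's identity for the truncated mean of a binomial random variable. -/
theorem sum_sub_mul_binomTerm {m : ℕ} (hm : m ≤ N) :
    ∑ j ∈ Finset.Ico m (N + 1), (j - N * p) * binomTerm N p j = m * (1 - p) * binomTerm N p m := by
  rw [Finset.sum_congr rfl fun j hj => (mul_binomTerm_sub_succ (p := p)
    (Nat.lt_succ_iff.1 (Finset.mem_Ico.1 hj).2)).symm,
    sum_Ico_sub_succ (by omega) fun j : ℕ => j * (1 - p) * binomTerm N p j,
    binomTerm_eq_zero (Nat.lt_succ_self N)]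
  ring

/-- Summation by parts of the same telescoping difference against j - m. -/
theorem sum_sub_mul_sub_mul_binomTerm {m : ℕ} (hm : m ≤ N) :
    ∑ j ∈ Finset.Ico m (N + 1), ((j : ℝ) - m) * ((j - N * p) * binomTerm N p j) =
      ∑ j ∈ Finset.Ico m (N + 1), ((N - j : ℝ) * p) * binomTerm N p j := by
  have h := sum_Ico_sub_succ (show m ≤ N + 1 by omega)
    fun j : ℕ => ((j : ℝ) - m) * (j * (1 - p) * binomTerm N p j)
  rw [binomTerm_eq_zero (Nat.lt_succ_self N), sub_self, zero_mul, mul_zero, mul_zero, sub_zero] at h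
  rw [← sub_eq_zero, ← h, ← Finset.sum_sub_distrib]
  refine Finset.sum_congr rfl fun j hj => ?_
  have hj' : j ≤ N := Nat.lt_succ_iff.1 (Finset.mem_Ico.1 hj).2
  have e := mul_binomTerm_sub_succ (p := p) hj'
  have e' := binomTerm_succ_mul (N := N) (p := p) j
  rw [Nat.cast_sub hj'] at e'
  push_cast at e ⊢
  linear_combination (-(j - m : ℝ)) * e + e'

variable {m : ℕ}

theorem mul_binomTail_le (h0 : 0 < p) (h1 : p < 1) (hm : m ≤ N) :
    (m - N * p) * binomTail N p m ≤ m * (1 - p) * binomTerm N p m := by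
  rw [← sum_sub_mul_binomTerm hm, binomTail, Finset.mul_sum]
  refine Finset.sum_le_sum fun j hj => mul_le_mul_of_nonneg_right ?_ (binomTerm_nonneg h0.le h1.le _)
  have : (m : ℝ) ≤ j := by exact_mod_cast (Finset.mem_Ico.1 hj).1
  linarith

/-- The truncated mean exceeds t times the tail by ∑ (j - m) b(j). Since j - Np ≥ t, t times this
excess is at most the truncated second moment above, which is at most Np(1-p) times the tail. -/
theorem mul_binomTerm_le (h0 : 0 < p) (h1 : p < 1) (hm : m ≤ N) (ht : 0 < m - N * p) :
    m * (1 - p) * binomTerm N p m ≤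
      (m - N * p + N * p * (1 - p) / (m - N * p)) * binomTail N p m := by
  set t := m - N * p with ht'
  have hb (j) := binomTerm_nonneg (N := N) h0.le h1.le j
  have hj {j : ℕ} (hj : j ∈ Finset.Ico m (N + 1)) : (m : ℝ) ≤ j := by
    exact_mod_cast (Finset.mem_Ico.1 hj).1
  have e : m * (1 - p) * binomTerm N p m =
      t * binomTail N p m + ∑ j ∈ Finset.Ico m (N + 1), (j - m) * binomTerm N p j := by
    rw [← sum_sub_mul_binomTerm hm, binomTail, Finset.mul_sum, ← Finset.sum_add_distrib]
    exact Finset.sum_congr rfl fun j _ => by rw [ht']; ring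
  have h2 : t * ∑ j ∈ Finset.Ico m (N + 1), (j - m) * binomTerm N p j ≤
      N * p * (1 - p) * binomTail N p m := by
    calc _ ≤ ∑ j ∈ Finset.Ico m (N + 1), ((j : ℝ) - m) * ((j - N * p) * binomTerm N p j) := by
          rw [Finset.mul_sum]
          refine Finset.sum_le_sum fun j h => ?_
          have h3 : 0 ≤ ((j : ℝ) - m) * binomTerm N p j :=
            mul_nonneg (by linarith [hj h]) (hb j)
          nlinarith [hj h]
      _ = ∑ j ∈ Finset.Ico m (N + 1), ((N - j : ℝ) * p) * binomTerm N p j :=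
          sum_sub_mul_sub_mul_binomTerm hm
      _ ≤ _ := by
          rw [binomTail, Finset.mul_sum]
          refine Finset.sum_le_sum fun j h => mul_le_mul_of_nonneg_right ?_ (hb j)
          have := hj h
          nlinarith
  have h3 : ∑ j ∈ Finset.Ico m (N + 1), (j - m) * binomTerm N p j ≤
      N * p * (1 - p) / t * binomTail N p m := by
    rw [div_mul_eq_mul_div, le_div_iff₀ ht]
    linarith
  rw [e, add_mul]
  linarith

/-- A bound for the hazard rate of a binomial random variable in the range of moderate
deviations. -/
theorem binomTail_le_mul_succ (h0 : 0 < p) (h1 : p < 1) {t v : ℝ} (hv : v = N * p * (1 - p))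
    (ht : t = (m + 1 : ℕ) - N * p) (ht0 : 0 < t) (htv : t ≤ v / 2) (hvt : v ≤ t ^ 2) :
    binomTail N p m ≤ (1 + 4 * t / v) * binomTail N p (m + 1) := by
  have hq : 0 < 1 - p := by linarith
  have hv0 : 0 < v := by linarith
  have hNm : (N - (m + 1 : ℕ)) * p = v - t * p := by rw [hv, ht]; ring
  have hpos : v / 2 ≤ (N - (m + 1 : ℕ)) * p := by nlinarith
  have hm : m + 1 ≤ N := by
    by_contra hlt
    have : (N : ℝ) ≤ (m + 1 : ℕ) := by exact_mod_cast (not_le.1 hlt).le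
    nlinarith
  have hlow := mul_binomTerm_le h0 h1 hm (ht ▸ ht0)
  rw [← ht, ← hv] at hlow
  have hb := binomTerm_succ_mul (N := N) (p := p) m
  rw [Nat.cast_sub (by omega)] at hb
  have hT := binomTail_nonneg (N := N) h0.le h1.le (m + 1)
  have hbm := binomTerm_nonneg (N := N) h0.le h1.le m
  have hvt' : v / t ≤ t := by rw [div_le_iff₀ ht0]; linarith
  push_cast at hlow hpos
  -- The mass at m is passed to m + 1 by the ratio identity, with (N - m)p ≥ v/2; then the Mills
  -- bound applies, with v/t ≤ t.
  have h3 : binomTerm N p m * (v / 2) ≤ (2 * t) * binomTail N p (m + 1) := by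
    calc binomTerm N p m * (v / 2) ≤ binomTerm N p m * ((N - m) * p) :=
          mul_le_mul_of_nonneg_left (by nlinarith) hbm
      _ = (m + 1) * (1 - p) * binomTerm N p (m + 1) := by linarith
      _ ≤ (t + v / t) * binomTail N p (m + 1) := hlow
      _ ≤ _ := mul_le_mul_of_nonneg_right (by linarith) hT
  have h4 : binomTerm N p m ≤ 4 * t / v * binomTail N p (m + 1) := by
    rw [div_mul_eq_mul_div, le_div_iff₀ hv0]
    linarith
  rw [binomTail_eq_add]
  linarith

end tailBounds

/-! ### Local limit theorem for moderate deviations -/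

section localLimit

open Filter Topology

theorem abs_one_add_mul_log_sub_le {x : ℝ} (hx : |x| ≤ 1 / 2) :
    |(1 + x) * Real.log (1 + x) - x - x ^ 2 / 2| ≤ 4 * |x| ^ 3 := by
  have h := Real.abs_log_sub_add_sum_range_le (x := -x) (by rw [abs_neg]; linarith) 2
  simp only [Finset.sum_range_succ, Finset.sum_range_zero, abs_neg, sub_neg_eq_add] at h
  norm_num at h
  have h3 : |x| ^ 3 / (1 - |x|) ≤ 2 * |x| ^ 3 := by
    rw [div_le_iff₀ (by linarith)]
    nlinarith [pow_nonneg (abs_nonneg x) 3]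
  set δ := -x + x ^ 2 / 2 + Real.log (1 + x) with hδ
  have e : (1 + x) * Real.log (1 + x) - x - x ^ 2 / 2 = (1 + x) * δ + -(x ^ 3 / 2) := by
    rw [hδ]; ring
  rw [e]
  refine (abs_add_le _ _).trans ?_
  rw [abs_mul, abs_neg, abs_div, abs_pow, abs_two]
  have h4 : |1 + x| ≤ 3 / 2 := (abs_add_le _ _).trans (by rw [abs_one]; linarith)
  have h5 : |δ| ≤ 2 * |x| ^ 3 := h.trans h3
  have := mul_le_mul h4 h5 (abs_nonneg _) (by norm_num)
  linarith [pow_nonneg (abs_nonneg x) 3]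

theorem factorial_eq_stirlingSeq_mul {n : ℕ} (hn : 0 < n) : (n.factorial : ℝ) =
    Stirling.stirlingSeq n * √(2 * n) * Real.exp (n * Real.log n - n) := by
  have hn' : (0 : ℝ) < n := by exact_mod_cast hn
  have e : ((n : ℝ) / Real.exp 1) ^ n = Real.exp (n * Real.log n - n) := by
    rw [div_pow, ← Real.exp_nat_mul, mul_one, Real.exp_sub, mul_comm (n : ℝ), ← Real.rpow_def_of_pos hn',
      Real.rpow_natCast]
  rw [← e, Stirling.stirlingSeq]
  have : 0 < √(2 * (n : ℝ)) := Real.sqrt_pos.2 (by positivity)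
  field_simp

/-- An exact identity: Stirling's error stays in the `stirlingSeq` factors, each tending to √π, and
the exponent is -N times the relative entropy of m/N with respect to p. -/
theorem binomTerm_eq_stirlingSeq {N m : ℕ} {p : ℝ} (h0 : 0 < p) (h1 : p < 1) (hm0 : 0 < m)
    (hm : m < N) : binomTerm N p m =
      Stirling.stirlingSeq N / (Stirling.stirlingSeq m * Stirling.stirlingSeq (N - m)) *
        √(N / (2 * (m * (N - m)))) *
        Real.exp (-(m * Real.log (m / (N * p)) +
          (N - m) * Real.log ((N - m) / (N * (1 - p))))) := by
  have hq : 0 < 1 - p := by linarith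
  have hd : 0 < N - m := Nat.sub_pos_of_lt hm
  have hN0 : 0 < N := by omega
  have hN' : (0 : ℝ) < N := by exact_mod_cast hN0
  have hm' : (0 : ℝ) < m := by exact_mod_cast hm0
  have hd' : (0 : ℝ) < N - m := by
    have : (m : ℝ) < N := by exact_mod_cast hm
    linarith
  have hpos : ∀ n : ℕ, 0 < n → 0 < Stirling.stirlingSeq n := fun n hn =>
    (Real.sqrt_pos.2 Real.pi_pos).trans_le (Stirling.sqrt_pi_le_stirlingSeq hn.ne')
  have s1 := hpos m hm0
  have s2 := hpos (N - m) hd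
  rw [binomTerm, Nat.cast_choose ℝ hm.le, factorial_eq_stirlingSeq_mul hN0,
    factorial_eq_stirlingSeq_mul hm0, factorial_eq_stirlingSeq_mul hd, Nat.cast_sub hm.le]
  have hsq : √(N / (2 * (m * (N - m))) : ℝ) = √(2 * N) / (√(2 * m) * √(2 * (N - m))) := by
    rw [← Real.sqrt_mul (by positivity), ← Real.sqrt_div' _ (by positivity)]
    congr 1
    field_simp
  have hpm : p ^ m = Real.exp (m * Real.log p) := by
    rw [mul_comm, ← Real.rpow_def_of_pos h0, Real.rpow_natCast]
  have hqm : (1 - p) ^ (N - m) = Real.exp ((N - m) * Real.log (1 - p)) := by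
    rw [← Nat.cast_sub hm.le, mul_comm, ← Real.rpow_def_of_pos hq, Real.rpow_natCast]
  rw [hsq, hpm, hqm, Real.log_div hm'.ne' (by positivity), Real.log_div hd'.ne' (by positivity),
    Real.log_mul hN'.ne' h0.ne', Real.log_mul hN'.ne' hq.ne']
  have e : -(m * (Real.log m - (Real.log N + Real.log p)) +
      (N - m) * (Real.log (N - m) - (Real.log N + Real.log (1 - p)))) =
      (N * Real.log N - N) - (m * Real.log m - m) - ((N - m) * Real.log (N - m) - (N - m)) +
        m * Real.log p + (N - m) * Real.log (1 - p) := by ring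
  rw [e]
  generalize N * Real.log N - N = A
  generalize m * Real.log m - m = B
  generalize (N - m) * Real.log (N - m) - (N - m : ℝ) = C
  rw [Real.exp_add, Real.exp_add, Real.exp_sub, Real.exp_sub]
  have r1 : 0 < √(2 * (m : ℝ)) := Real.sqrt_pos.2 (by positivity)
  have r2 : 0 < √(2 * ((N : ℝ) - m)) := Real.sqrt_pos.2 (by positivity)
  field_simp

variable {ι : Type*} {l : Filter ι} {t v : ι → ℝ}

theorem eventually_one_le_of_moderate (h1 : Tendsto (fun i => t i / √(v i)) l atTop) :
    ∀ᶠ i in l, 0 < v i ∧ √(v i) ≤ t i := by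
  filter_upwards [h1.eventually_ge_atTop 1] with i hi
  have hv : 0 < √(v i) := by
    rcases (Real.sqrt_nonneg (v i)).eq_or_lt with h | h
    -- Positivity of v is forced: with √v = 0 the quotient would be 0.
    · rw [← h, div_zero] at hi
      norm_num at hi
    · exact h
  exact ⟨Real.sqrt_pos.1 hv, by rwa [le_div_iff₀ hv, one_mul] at hi⟩

theorem tendsto_div_of_moderate (h1 : Tendsto (fun i => t i / √(v i)) l atTop)
    (h2 : Tendsto (fun i => t i ^ 3 / v i ^ 2) l (𝓝 0)) :
    Tendsto (fun i => t i / v i) l (𝓝 0) := by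
  refine tendsto_of_tendsto_of_tendsto_of_le_of_le' tendsto_const_nhds h2 ?_ ?_ <;>
  filter_upwards [eventually_one_le_of_moderate h1] with i ⟨hv, ht⟩
  · have := Real.sqrt_pos.2 hv
    have : 0 < t i := by linarith
    positivity
  · have hs := Real.sqrt_pos.2 hv
    have ht0 : 0 < t i := by linarith
    have : v i ≤ t i ^ 2 := by
      rw [← Real.sq_sqrt hv.le]
      exact pow_le_pow_left₀ hs.le ht 2
    rw [div_le_div_iff₀ hv (by positivity)]
    calc t i * v i ^ 2 = t i * v i * v i := by ring
      _ ≤ t i * v i * t i ^ 2 := mul_le_mul_of_nonneg_left this (by positivity)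
      _ = _ := by ring

/-- The quotient v/t diverges, and t ≥ 1 eventually, so v ≥ v/t. -/
theorem tendsto_atTop_of_moderate (h1 : Tendsto (fun i => t i / √(v i)) l atTop)
    (h2 : Tendsto (fun i => t i ^ 3 / v i ^ 2) l (𝓝 0)) : Tendsto v l atTop := by
  have hx : Tendsto (fun i => (t i / v i)⁻¹) l atTop :=
    tendsto_inv_nhdsGT_zero.comp <| tendsto_nhdsWithin_iff.2 ⟨tendsto_div_of_moderate h1 h2, by
      filter_upwards [eventually_one_le_of_moderate h1] with i ⟨hv, ht⟩
      have := Real.sqrt_pos.2 hv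
      exact div_pos (by linarith) hv⟩
  refine tendsto_atTop_mono' l ?_ hx
  filter_upwards [eventually_one_le_of_moderate h1, hx.eventually_ge_atTop 1] with i ⟨hv, ht⟩ hi
  have hs := Real.sqrt_pos.2 hv
  have e := Real.sq_sqrt hv.le
  rw [inv_div, div_le_iff₀ (by linarith)]
  rw [inv_div, le_div_iff₀ (by linarith), one_mul] at hi
  have h1s : 1 ≤ √(v i) := by nlinarith
  have : 1 ≤ t i := by linarith
  nlinarith

variable {N m : ι → ℕ} {p : ι → ℝ}

/-- The local limit theorem for binomial distributions in the range of moderate deviations. -/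
theorem tendsto_binomTerm_mul_exp (hp : ∀ᶠ i in l, 0 < p i ∧ p i < 1)
    (hv : ∀ i, v i = N i * p i * (1 - p i)) (ht : ∀ i, t i = m i - N i * p i)
    (h1 : Tendsto (fun i => t i / √(v i)) l atTop)
    (h2 : Tendsto (fun i => t i ^ 3 / v i ^ 2) l (𝓝 0)) :
    Tendsto (fun i => binomTerm (N i) (p i) (m i) * √(2 * Real.pi * v i) *
      Real.exp (t i ^ 2 / (2 * v i))) l (𝓝 1) := by
  have hd := tendsto_div_of_moderate h1 h2
  have hvt := tendsto_atTop_of_moderate h1 h2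
  have hbase : ∀ᶠ i in l, 0 < p i ∧ p i < 1 ∧ 0 < v i ∧ 0 < t i ∧ t i / v i ≤ 1 / 2 := by
    filter_upwards [hp, eventually_one_le_of_moderate h1, hd.eventually_le_const (by norm_num :
      (0 : ℝ) < 1 / 2)] with i ⟨a, b⟩ ⟨c, d⟩ e
    exact ⟨a, b, c, (Real.sqrt_pos.2 c).trans_le d, e⟩
  have facts : ∀ᶠ i in l, 0 < p i ∧ p i < 1 ∧ 0 < v i ∧ 0 < t i ∧ t i / v i ≤ 1 / 2 ∧
      v i ≤ N i * p i ∧ v i ≤ N i * (1 - p i) ∧ v i ≤ m i ∧ v i / 2 ≤ (N i : ℝ) - m i ∧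
      0 < m i ∧ m i < N i := by
    filter_upwards [hbase] with i ⟨a, b, c, d, e⟩
    have a1 : v i ≤ N i * p i := by
      rw [hv]
      exact mul_le_of_le_one_right (by positivity) (by linarith)
    have a2 : v i ≤ N i * (1 - p i) := by
      rw [hv, mul_right_comm]
      exact mul_le_of_le_one_right (mul_nonneg (by positivity) (by linarith)) b.le
    have a3 : v i ≤ m i := by linarith [ht i]
    rw [div_le_iff₀ c] at e
    have a4 : v i / 2 ≤ (N i : ℝ) - m i := by linarith [ht i]
    refine ⟨a, b, c, d, by rwa [div_le_iff₀ c], a1, a2, a3, a4, ?_, ?_⟩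
    · exact_mod_cast c.trans_le a3
    · have : (m i : ℝ) < N i := by linarith
      exact_mod_cast this
  -- Relative deviations of m and N - m from their means; both are at most t/v.
  let x : ι → ℝ := fun i => t i / (N i * p i)
  let y : ι → ℝ := fun i => t i / (N i * (1 - p i))
  have hxy : ∀ᶠ i in l, 0 ≤ x i ∧ x i ≤ t i / v i ∧ 0 ≤ y i ∧ y i ≤ t i / v i := by
    filter_upwards [facts] with i ⟨a, b, c, d, e, a1, a2, _⟩
    exact ⟨div_nonneg d.le (by linarith), div_le_div_of_nonneg_left d.le c a1,
      div_nonneg d.le (by linarith), div_le_div_of_nonneg_left d.le c a2⟩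
  have hx : Tendsto x l (𝓝 0) := tendsto_of_tendsto_of_tendsto_of_le_of_le' tendsto_const_nhds hd
    (hxy.mono fun i h => h.1) (hxy.mono fun i h => h.2.1)
  have hy : Tendsto y l (𝓝 0) := tendsto_of_tendsto_of_tendsto_of_le_of_le' tendsto_const_nhds hd
    (hxy.mono fun i h => h.2.2.1) (hxy.mono fun i h => h.2.2.2)
  have hmN : Tendsto m l atTop := tendsto_natCast_atTop_iff.1 <|
    tendsto_atTop_mono' l (facts.mono fun i h => h.2.2.2.2.2.2.2.1) hvt
  have hNm : Tendsto (fun i => N i - m i) l atTop := by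
    refine tendsto_natCast_atTop_iff.1 <|
      tendsto_atTop_mono' l ?_ (hvt.atTop_div_const (by norm_num : (0 : ℝ) < 2))
    filter_upwards [facts] with i ⟨_, _, _, _, _, _, _, _, h, _, h'⟩
    rwa [Nat.cast_sub h'.le]
  have hNN : Tendsto N l atTop := tendsto_atTop_mono' l (facts.mono fun i h => h.2.2.2.2.2.2.2.2.2.2.le) hmN
  have hπ : √Real.pi ≠ 0 := (Real.sqrt_pos.2 Real.pi_pos).ne'
  have st := Stirling.tendsto_stirlingSeq_sqrt_pi
  have F1 : Tendsto (fun i => Stirling.stirlingSeq (N i) /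
      (Stirling.stirlingSeq (m i) * Stirling.stirlingSeq (N i - m i)) * √Real.pi) l (𝓝 1) := by
    have := ((st.comp hNN).div ((st.comp hmN).mul (st.comp hNm)) (mul_ne_zero hπ hπ)).mul_const
      √Real.pi
    rwa [div_mul_eq_mul_div, div_self (mul_ne_zero hπ hπ)] at this
  have F2 : Tendsto (fun i => √(1 / ((1 + x i) * (1 - y i)))) l (𝓝 1) := by
    have h : Tendsto (fun i => 1 / ((1 + x i) * (1 - y i))) l (𝓝 (1 / ((1 + 0) * (1 - 0)))) :=
      tendsto_const_nhds.div ((tendsto_const_nhds.add hx).mul (tendsto_const_nhds.sub hy))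
        (by norm_num)
    have := h.sqrt
    simpa using this
  -- Expanding the entropy, the linear terms cancel because Np·x = N(1-p)·y = t, the quadratic ones
  -- give t²/(2v), and each cubic error is at most 4t³/v².
  have F3 : Tendsto (fun i => t i ^ 2 / (2 * v i) -
      (m i * Real.log (m i / (N i * p i)) +
          (N i - m i) * Real.log ((N i - m i) / (N i * (1 - p i))))) l (𝓝 0) := by
    have h8 : Tendsto (fun i => 8 * (t i ^ 3 / v i ^ 2)) l (𝓝 0) := by simpa using h2.const_mul 8
    refine squeeze_zero_norm' ?_ h8
    filter_upwards [facts, hxy] with i ⟨a, b, c, d, e, a1, a2, a3, a4, hm0, hmN⟩ ⟨x0, x1, y0, y1⟩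
    have hq : 0 < 1 - p i := by linarith
    have hNp : 0 < N i * p i := c.trans_le a1
    have hNq : 0 < N i * (1 - p i) := c.trans_le a2
    have hN : (0 : ℝ) < N i := by
      have : 0 < N i := by omega
      exact_mod_cast this
    have e1 : (m i : ℝ) = N i * p i * (1 + x i) := by
      simp only [x]; rw [mul_add, mul_div_cancel₀ _ hNp.ne']; linarith [ht i]
    have e2 : (N i - m i : ℝ) = N i * (1 - p i) * (1 + -y i) := by
      simp only [y]; rw [mul_add, mul_neg, mul_div_cancel₀ _ hNq.ne']; linarith [ht i]
    have e3 : (m i : ℝ) / (N i * p i) = 1 + x i := by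
      rw [e1, mul_div_cancel_left₀ _ hNp.ne']
    have e4 : (N i - m i : ℝ) / (N i * (1 - p i)) = 1 + -y i := by
      rw [e2, mul_div_cancel_left₀ _ hNq.ne']
    rw [e3, e4, e2, e1]
    have b1 := abs_one_add_mul_log_sub_le (x := x i) (by rw [abs_of_nonneg x0]; linarith)
    have b2 := abs_one_add_mul_log_sub_le (x := -y i) (by rw [abs_neg, abs_of_nonneg y0]; linarith)
    rw [abs_neg, abs_of_nonneg y0] at b2
    rw [abs_of_nonneg x0] at b1
    have e5 : N i * p i * x i = t i := mul_div_cancel₀ _ hNp.ne'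
    have e6 : N i * (1 - p i) * y i = t i := mul_div_cancel₀ _ hNq.ne'
    have e7 : t i ^ 2 / (2 * v i) = N i * p i * x i ^ 2 / 2 + N i * (1 - p i) * y i ^ 2 / 2 := by
      simp only [x, y]
      rw [hv]
      field_simp
      ring
    have e8 : t i ^ 2 / (2 * v i) - (N i * p i * (1 + x i) * Real.log (1 + x i) +
        N i * (1 - p i) * (1 + -y i) * Real.log (1 + -y i)) =
        -(N i * p i * ((1 + x i) * Real.log (1 + x i) - x i - x i ^ 2 / 2)) -
          N i * (1 - p i) * ((1 + -y i) * Real.log (1 + -y i) - -y i - (-y i) ^ 2 / 2) := by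
      rw [e7]
      linear_combination e6 - e5
    have c1 : N i * p i * x i ^ 3 ≤ t i ^ 3 / v i ^ 2 := by
      have : x i ^ 2 ≤ (t i / v i) ^ 2 := pow_le_pow_left₀ x0 x1 2
      calc _ = t i * x i ^ 2 := by rw [← e5]; ring
        _ ≤ t i * (t i / v i) ^ 2 := mul_le_mul_of_nonneg_left this d.le
        _ = _ := by rw [div_pow]; ring
    have c2 : N i * (1 - p i) * y i ^ 3 ≤ t i ^ 3 / v i ^ 2 := by
      have : y i ^ 2 ≤ (t i / v i) ^ 2 := pow_le_pow_left₀ y0 y1 2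
      calc _ = t i * y i ^ 2 := by rw [← e6]; ring
        _ ≤ t i * (t i / v i) ^ 2 := mul_le_mul_of_nonneg_left this d.le
        _ = _ := by rw [div_pow]; ring
    rw [Real.norm_eq_abs, e8]
    refine (abs_sub _ _).trans ?_
    rw [abs_neg, abs_mul (N i * p i), abs_mul (N i * (1 - p i)), abs_of_pos hNp, abs_of_pos hNq]
    have d1 := mul_le_mul_of_nonneg_left b1 hNp.le
    have d2 := mul_le_mul_of_nonneg_left b2 hNq.le
    linarith
  have F := (F1.mul F2).mul ((Real.continuous_exp.tendsto 0).comp F3)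
  rw [Real.exp_zero, one_mul, one_mul] at F
  refine F.congr' ?_
  filter_upwards [facts] with i ⟨a, b, c, d, e, a1, a2, a3, a4, hm0, hmN⟩
  have hq : 0 < 1 - p i := by linarith
  have hNp : 0 < N i * p i := c.trans_le a1
  have hNq : 0 < N i * (1 - p i) := c.trans_le a2
  have hN : (0 : ℝ) < N i := by
    have : 0 < N i := by omega
    exact_mod_cast this
  have e1 : (m i : ℝ) = N i * p i * (1 + x i) := by
    simp only [x]; rw [mul_add, mul_div_cancel₀ _ hNp.ne']; linarith [ht i]
  have e2 : (N i - m i : ℝ) = N i * (1 - p i) * (1 - y i) := by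
    simp only [y]; rw [mul_sub, mul_div_cancel₀ _ hNq.ne']; linarith [ht i]
  have e3 : √Real.pi * √(1 / ((1 + x i) * (1 - y i))) =
      √(N i / (2 * (m i * (N i - m i)))) * √(2 * Real.pi * v i) := by
    have hnn : 0 ≤ (N i : ℝ) / (2 * (m i * (N i - m i))) := by
      have : (0 : ℝ) ≤ N i - m i := by linarith
      positivity
    rw [← Real.sqrt_mul Real.pi_pos.le, ← Real.sqrt_mul hnn]
    congr 1
    rw [e2, e1, hv]
    have hx1 : 1 + x i ≠ 0 := fun h => by rw [h, mul_zero] at e1; linarith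
    have hy1 : 1 - y i ≠ 0 := fun h => by rw [h, mul_zero] at e2; linarith
    field_simp
  rw [binomTerm_eq_stirlingSeq a b hm0 hmN]
  have hexp (a b : ℝ) : Real.exp (a - b) = Real.exp a * Real.exp (-b) := by
    rw [← Real.exp_add, ← sub_eq_add_neg]
  simp only [Function.comp_apply]
  rw [hexp]
  linear_combination (Stirling.stirlingSeq (N i) /
      (Stirling.stirlingSeq (m i) * Stirling.stirlingSeq (N i - m i)) *
      Real.exp (t i ^ 2 / (2 * v i)) * Real.exp (-(m i * Real.log (m i / (N i * p i)) +
          (N i - m i) * Real.log ((N i - m i) / (N i * (1 - p i)))))) * e3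

/-- The tail of binomial distributions in the range of moderate deviations. -/
theorem tendsto_binomTail_mul_exp (hp : ∀ᶠ i in l, 0 < p i ∧ p i < 1)
    (hv : ∀ i, v i = N i * p i * (1 - p i)) (ht : ∀ i, t i = m i - N i * p i)
    (h1 : Tendsto (fun i => t i / √(v i)) l atTop)
    (h2 : Tendsto (fun i => t i ^ 3 / v i ^ 2) l (𝓝 0)) :
    Tendsto (fun i => binomTail (N i) (p i) (m i) * √(2 * Real.pi) * (t i / √(v i)) *
      Real.exp (t i ^ 2 / (2 * v i))) l (𝓝 1) := by
  have hd := tendsto_div_of_moderate h1 h2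
  have facts : ∀ᶠ i in l, 0 < p i ∧ p i < 1 ∧ 0 < v i ∧ 0 < t i ∧ v i ≤ N i * p i ∧ m i ≤ N i := by
    filter_upwards [hp, eventually_one_le_of_moderate h1, hd.eventually_le_const (by norm_num :
      (0 : ℝ) < 1 / 2)] with i ⟨a, b⟩ ⟨c, d⟩ e
    have a1 : v i ≤ N i * p i := by
      rw [hv]
      exact mul_le_of_le_one_right (by positivity) (by linarith)
    have a2 : v i ≤ N i * (1 - p i) := by
      rw [hv, mul_right_comm]
      exact mul_le_of_le_one_right (mul_nonneg (by positivity) (by linarith)) b.le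
    refine ⟨a, b, c, (Real.sqrt_pos.2 c).trans_le d, a1, ?_⟩
    rw [div_le_iff₀ c] at e
    have : (m i : ℝ) ≤ N i := by linarith [ht i]
    exact_mod_cast this
  have hx : Tendsto (fun i => (m i : ℝ) / (N i * p i)) l (𝓝 1) := by
    have hup : Tendsto (fun i => 1 + t i / v i) l (𝓝 1) := by simpa using hd.const_add 1
    refine tendsto_of_tendsto_of_tendsto_of_le_of_le' tendsto_const_nhds hup ?_ ?_ <;>
    filter_upwards [facts] with i ⟨a, b, c, d, a1, _⟩
    · rw [le_div_iff₀ (by linarith)]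
      linarith [ht i]
    · have e : (m i : ℝ) / (N i * p i) = 1 + t i / (N i * p i) := by
        have : N i * p i ≠ 0 := by linarith
        rw [ht, sub_div, div_self this]
        ring
      rw [e]
      exact add_le_add le_rfl (div_le_div_of_nonneg_left d.le c a1)
  have hr : Tendsto (fun i => 1 + v i / t i ^ 2) l (𝓝 1) := by
    have h : Tendsto (fun i => 1 + ((t i / √(v i)) ^ 2)⁻¹) l (𝓝 (1 + 0)) :=
      tendsto_const_nhds.add
        (tendsto_inv_atTop_zero.comp ((tendsto_pow_atTop (two_ne_zero)).comp h1))
    rw [add_zero] at h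
    refine h.congr' ?_
    filter_upwards [facts] with i ⟨a, b, c, _⟩
    rw [div_pow, Real.sq_sqrt c.le, inv_div]
  -- The two Mills bounds enclose this ratio between (m/Np)/(1 + v/t²) and m/Np.
  have ratio : Tendsto (fun i => binomTail (N i) (p i) (m i) * t i /
      (v i * binomTerm (N i) (p i) (m i))) l (𝓝 1) := by
    have hlow := hx.div hr one_ne_zero
    rw [div_one] at hlow
    refine tendsto_of_tendsto_of_tendsto_of_le_of_le' hlow hx ?_ ?_ <;>
    filter_upwards [facts] with i ⟨a, b, c, d, a1, a2⟩
    · have hb := binomTerm_pos a b a2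
      have hNp : N i * p i ≠ 0 := by linarith
      have h := mul_binomTerm_le a b a2 (by rw [← ht]; exact d)
      rw [← ht, ← hv] at h
      simp only [Pi.div_apply]
      rw [div_le_div_iff₀ (by positivity) (by positivity)]
      have e1 : t i + v i / t i = t i * (1 + v i / t i ^ 2) := by field_simp
      have e2 : (m i : ℝ) / (N i * p i) * (v i * binomTerm (N i) (p i) (m i)) =
          m i * (1 - p i) * binomTerm (N i) (p i) (m i) := by
        rw [hv]
        have := left_ne_zero_of_mul hNp
        field_simp
      rw [e2]
      refine h.trans_eq ?_
      rw [e1]; ring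
    · have hb := binomTerm_pos a b a2
      have hNp : N i * p i ≠ 0 := by linarith
      have h := mul_binomTail_le a b a2
      rw [← ht] at h
      rw [div_le_iff₀ (by positivity)]
      have e2 : (m i : ℝ) / (N i * p i) * (v i * binomTerm (N i) (p i) (m i)) =
          m i * (1 - p i) * binomTerm (N i) (p i) (m i) := by
        rw [hv]
        have := left_ne_zero_of_mul hNp
        field_simp
      rw [e2]
      linarith
  have F := ratio.mul (tendsto_binomTerm_mul_exp hp hv ht h1 h2)
  rw [one_mul] at F
  refine F.congr' ?_
  filter_upwards [facts] with i ⟨a, b, c, d, a1, a2⟩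
  have hb := binomTerm_pos a b a2
  have hs := Real.sqrt_pos.2 c
  rw [Real.sqrt_mul (by positivity) (v i)]
  nth_rewrite 1 [← Real.sq_sqrt c.le]
  field_simp

end localLimit

/-! ### Asymptotics at the Gumbel threshold -/

section gumbelThreshold

open Filter Topology

variable {ι : Type*} {l : Filter ι} {L v v' t : ι → ℝ} {c x : ℝ}

theorem tendsto_atTop_of_pow_three_div (hL : Tendsto L l atTop) (hvpos : ∀ᶠ i in l, 0 < v i)
    (hv : Tendsto (fun i => L i ^ 3 / v i) l (𝓝 0)) : Tendsto v l atTop := by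
  refine tendsto_atTop_mono' l ?_ ((tendsto_pow_atTop three_ne_zero).comp hL)
  filter_upwards [hvpos, hv.eventually_le_const one_pos] with i hi h
  simpa [div_le_iff₀ hi] using h

theorem tendsto_div_one_of_mul_sub_one (hL : Tendsto L l atTop)
    (hv' : Tendsto (fun i => L i * (v' i / v i - 1)) l (𝓝 0)) :
    Tendsto (fun i => v' i / v i) l (𝓝 1) := by
  have h := (hv'.mul (tendsto_inv_atTop_zero.comp hL)).add_const 1
  rw [zero_mul, zero_add] at h
  refine h.congr' ?_
  filter_upwards [hL.eventually_gt_atTop 0] with i hi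
  simp only [Function.comp_apply]
  field_simp
  ring

theorem tendsto_mul_inv_sub_one (hL : Tendsto L l atTop) (hvpos : ∀ᶠ i in l, 0 < v i)
    (hv' : Tendsto (fun i => L i * (v' i / v i - 1)) l (𝓝 0)) :
    Tendsto (fun i => L i * (v i / v' i - 1)) l (𝓝 0) := by
  have h1 := tendsto_div_one_of_mul_sub_one hL hv'
  have h := (hv'.mul (h1.inv₀ one_ne_zero)).neg
  rw [zero_mul, neg_zero] at h
  refine h.congr' ?_
  filter_upwards [hvpos, h1.eventually_const_lt one_pos] with i hi h2
  have : 0 < v' i := (div_pos_iff_of_pos_right hi).1 h2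
  field_simp
  ring

/-- The threshold for the extremes, on the scale of its leading term and to second order. -/
theorem tendsto_threshold (hL : Tendsto L l atTop) (hvpos : ∀ᶠ i in l, 0 < v i)
    (hv : Tendsto (fun i => L i ^ 3 / v i) l (𝓝 0))
    (hv' : Tendsto (fun i => L i * (v' i / v i - 1)) l (𝓝 0))
    (ht : ∀ᶠ i in l, |t i - (√(2 * v i * L i) *
      (1 - Real.log (L i) / (4 * L i) - c / (2 * L i)) + x * √(v i / (2 * L i)))| ≤ 2) :
    Tendsto (fun i => t i / √(v' i) / √(2 * L i)) l (𝓝 1) ∧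
    Tendsto (fun i => t i ^ 2 / (2 * v' i) - (L i - Real.log (L i) / 2 - c + x)) l (𝓝 0) := by
  have hvtop := tendsto_atTop_of_pow_three_div hL hvpos hv
  have hratio := tendsto_div_one_of_mul_sub_one hL hv'
  have hinv := tendsto_mul_inv_sub_one hL hvpos hv'
  have hpos : ∀ᶠ i in l, 0 < v i ∧ 0 < v' i ∧ 0 < L i := by
    filter_upwards [hvpos, hratio.eventually_const_lt one_pos, hL.eventually_gt_atTop 0] with i a b c
    exact ⟨a, (div_pos_iff_of_pos_right a).1 b, c⟩
  let w : ι → ℝ := fun i => Real.log (L i) + 2 * c - 2 * x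
  -- In units of √(2vL) the threshold is 1 - ε + δ: ε gathers the log log, constant and x terms, δ
  -- the rounding error of at most 2.
  let ε : ι → ℝ := fun i => w i / (4 * L i)
  let E : ι → ℝ := fun i => t i / √(2 * v i * L i)
  let δ : ι → ℝ := fun i => E i - (1 - ε i)
  have hLinv := tendsto_inv_atTop_zero.comp hL
  have hlog1 : Tendsto (fun i => Real.log (L i) / L i) l (𝓝 0) := by
    have := (Real.isLittleO_pow_log_id_atTop (n := 1)).tendsto_div_nhds_zero.comp hL
    simpa [Function.comp_def] using this
  have hlog2 : Tendsto (fun i => Real.log (L i) ^ 2 / L i) l (𝓝 0) :=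
    (Real.isLittleO_pow_log_id_atTop (n := 2)).tendsto_div_nhds_zero.comp hL
  have hε : Tendsto ε l (𝓝 0) := by
    have h := ((hlog1.const_mul (1 / 4)).add (hLinv.const_mul ((2 * c - 2 * x) / 4)))
    simp only [mul_zero, add_zero] at h
    refine h.congr fun i => ?_
    simp only [ε, w, Function.comp_apply, div_eq_mul_inv, mul_inv]
    ring
  have hε2 : Tendsto (fun i => L i * ε i ^ 2) l (𝓝 0) := by
    have h := ((hlog2.const_mul (1 / 16)).add (hlog1.const_mul ((2 * c - 2 * x) / 8))).add
      (hLinv.const_mul ((2 * c - 2 * x) ^ 2 / 16))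
    simp only [mul_zero, add_zero] at h
    refine h.congr' ?_
    filter_upwards [hpos] with i ⟨_, _, hi⟩
    simp only [ε, w, Function.comp_apply]
    field_simp
    ring
  have hLv : Tendsto (fun i => √(2 * (L i / v i))) l (𝓝 0) := by
    have h : Tendsto (fun i => L i / v i) l (𝓝 0) := by
      refine tendsto_of_tendsto_of_tendsto_of_le_of_le' tendsto_const_nhds hv ?_ ?_ <;>
      filter_upwards [hpos, hL.eventually_ge_atTop 1] with i ⟨a, _, b⟩ h1
      · positivity
      · refine div_le_div_of_nonneg_right ?_ a.le
        exact le_self_pow₀ h1 three_ne_zero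
    have := (h.const_mul 2).sqrt
    simpa using this
  have hLδ : Tendsto (fun i => L i * δ i) l (𝓝 0) := by
    refine squeeze_zero_norm' ?_ hLv
    filter_upwards [hpos, ht] with i ⟨a, _, b⟩ h
    have hs : 0 < √(2 * v i * L i) := Real.sqrt_pos.2 (by positivity)
    have e1 : √(v i / (2 * L i)) = √(2 * v i * L i) / (2 * L i) := by
      have h4 : v i / (2 * L i) = (2 * v i * L i) / (2 * L i) ^ 2 := by
        field_simp
      rw [h4, Real.sqrt_div' _ (by positivity), Real.sqrt_sq (by positivity)]
    have e2 : t i - (√(2 * v i * L i) * (1 - Real.log (L i) / (4 * L i) - c / (2 * L i)) +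
        x * √(v i / (2 * L i))) = √(2 * v i * L i) * δ i := by
      rw [e1]
      simp only [δ, E, ε, w]
      field_simp
      ring
    rw [e2, abs_mul, abs_of_pos hs] at h
    have e3 : √(2 * (L i / v i)) = 2 * L i / √(2 * v i * L i) := by
      have h4 : 2 * (L i / v i) = (2 * L i) ^ 2 / (2 * v i * L i) := by
        field_simp
      rw [h4, Real.sqrt_div (by positivity), Real.sqrt_sq (by positivity)]
    rw [Real.norm_eq_abs, abs_mul, abs_of_pos b, e3, le_div_iff₀ hs]
    nlinarith
  have hδ : Tendsto δ l (𝓝 0) := by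
    have h := hLδ.mul hLinv
    rw [zero_mul] at h
    refine h.congr' ?_
    filter_upwards [hpos] with i ⟨_, _, hi⟩
    simp only [Function.comp_apply]
    field_simp
  have hE : Tendsto E l (𝓝 1) := by
    have h := hδ.add (hε.const_sub 1)
    rw [sub_zero, zero_add] at h
    refine h.congr fun i => ?_
    simp only [δ]
    ring
  constructor
  · have h := hE.mul ((hratio.inv₀ one_ne_zero).sqrt)
    rw [inv_one, Real.sqrt_one, one_mul] at h
    refine h.congr' ?_
    filter_upwards [hpos] with i ⟨a, b, d⟩
    simp only [E]
    have e : √(2 * v i * L i) = √(v i) * √(2 * L i) := by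
      rw [← Real.sqrt_mul a.le]; congr 1; ring
    rw [inv_div, Real.sqrt_div a.le, e]
    have := Real.sqrt_pos.2 a
    have := Real.sqrt_pos.2 b
    field_simp
  -- Expansion of L(1 - ε + δ)²·v/v': only L - 2Lε survives, the four summands being the change of
  -- variance, Lε², 2Lδ(1 - ε) and Lδ².
  · have h := ((((hE.pow 2).mul hinv).add hε2).add ((hLδ.const_mul 2).mul (hε.const_sub 1))).add
      (hLδ.mul hδ)
    simp only [mul_zero, zero_mul, add_zero] at h
    refine h.congr' ?_
    filter_upwards [hpos] with i ⟨a, b, d⟩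
    have hs : 0 < 2 * v i * L i := by positivity
    have e1 : t i ^ 2 / (2 * v' i) = L i * E i ^ 2 * (v i / v' i) := by
      simp only [E]
      rw [div_pow, Real.sq_sqrt hs.le]
      field_simp
    have e2 : L i - Real.log (L i) / 2 - c + x = L i - 2 * L i * ε i := by
      simp only [ε, w]
      field_simp
      ring
    rw [e1, e2]
    have e3 : E i = 1 - ε i + δ i := by simp only [δ]; ring
    rw [e3]
    ring

/-- At the Gumbel threshold, the ratio of the threshold to the standard deviation diverges, but
slowly enough for the moderate deviations regime. -/
theorem moderate_of_threshold (hL : Tendsto L l atTop) (hvpos : ∀ᶠ i in l, 0 < v i)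
    (hv : Tendsto (fun i => L i ^ 3 / v i) l (𝓝 0))
    (hv' : Tendsto (fun i => L i * (v' i / v i - 1)) l (𝓝 0))
    (hr : Tendsto (fun i => t i / √(v' i) / √(2 * L i)) l (𝓝 1)) :
    Tendsto (fun i => t i / √(v' i)) l atTop ∧
      Tendsto (fun i => t i ^ 3 / v' i ^ 2) l (𝓝 0) := by
  have hratio := tendsto_div_one_of_mul_sub_one hL hv'
  have hpos : ∀ᶠ i in l, 0 < v i ∧ 0 < v' i ∧ 0 < L i := by
    filter_upwards [hvpos, hratio.eventually_const_lt one_pos, hL.eventually_gt_atTop 0] with i a b c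
    exact ⟨a, (div_pos_iff_of_pos_right a).1 b, c⟩
  have hsq : Tendsto (fun i => √(2 * L i)) l atTop :=
    Real.tendsto_sqrt_atTop.comp (hL.const_mul_atTop two_pos)
  constructor
  · refine (hr.pos_mul_atTop one_pos hsq).congr' ?_
    filter_upwards [hpos] with i ⟨_, _, d⟩
    exact div_mul_cancel₀ _ (Real.sqrt_pos.2 (by positivity)).ne'
  -- The quantity t³/v'² is the cube of a quotient tending to 1, times √((2L)³/v'), which vanishes
  -- by L³ = o(v).
  · have h := (hr.pow 3).mul (((hv.mul (hratio.inv₀ one_ne_zero)).const_mul 8).sqrt)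
    rw [zero_mul, mul_zero, Real.sqrt_zero, mul_zero] at h
    refine h.congr' ?_
    filter_upwards [hpos] with i ⟨a, b, d⟩
    have e : 8 * (L i ^ 3 / v i * (v' i / v i)⁻¹) = (2 * L i) ^ 3 / v' i := by
      field_simp
      ring
    have e3 : √((2 * L i) ^ 3) = √(2 * L i) ^ 3 := by
      rw [Real.sqrt_eq_iff_eq_sq (by positivity) (by positivity), ← pow_mul, mul_comm 3, pow_mul,
        Real.sq_sqrt (by positivity)]
    have h1 := Real.sqrt_pos.2 b
    have h2 : 0 < √(2 * L i) := Real.sqrt_pos.2 (by positivity)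
    rw [e, Real.sqrt_div (by positivity), e3]
    have h4 : v' i ^ 2 = √(v' i) ^ 4 := by
      rw [show 4 = 2 * 2 by rfl, pow_mul, Real.sq_sqrt b.le]
    rw [h4]
    field_simp

/-- The expected number of exceedances of the Gumbel threshold. -/
theorem tendsto_exp_mul_binomTail {N m : ι → ℕ} {p : ι → ℝ} (hL : Tendsto L l atTop)
    (hp : ∀ᶠ i in l, 0 < p i ∧ p i < 1)
    (hv'N : ∀ i, v' i = N i * p i * (1 - p i)) (htm : ∀ i, t i = m i - N i * p i)
    (h1 : Tendsto (fun i => t i / √(v' i)) l atTop)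
    (h2 : Tendsto (fun i => t i ^ 3 / v' i ^ 2) l (𝓝 0))
    (hr : Tendsto (fun i => t i / √(v' i) / √(2 * L i)) l (𝓝 1))
    (hr2 : Tendsto (fun i => t i ^ 2 / (2 * v' i) -
      (L i - Real.log (L i) / 2 - Real.log (2 * √Real.pi) + x)) l (𝓝 0)) :
    Tendsto (fun i => Real.exp (L i) * binomTail (N i) (p i) (m i)) l (𝓝 (Real.exp (-x))) := by
  have hT := tendsto_binomTail_mul_exp hp hv'N htm h1 h2
  -- The Mills denominator √(2π)·√(2L) equals 2√π·√L, exactly what the log log and log(2√π)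
  -- corrections in the exponent compensate.
  have h := (hT.div (hr.mul ((Real.continuous_exp.tendsto 0).comp hr2)) (by simp)).mul_const
    (Real.exp (-x))
  rw [Real.exp_zero, mul_one, div_one, one_mul] at h
  refine h.congr' ?_
  filter_upwards [hL.eventually_gt_atTop 0, h1.eventually_gt_atTop 0] with i hi hti
  simp only [Pi.div_apply, Function.comp_apply]
  have hs : 0 < √(2 * L i) := Real.sqrt_pos.2 (by positivity)
  have hπ : 0 < √Real.pi := Real.sqrt_pos.2 Real.pi_pos
  have hsL : 0 < √(L i) := Real.sqrt_pos.2 hi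
  have e1 : Real.exp (Real.log (L i) / 2) = √(L i) := by
    rw [Real.sqrt_eq_rpow, Real.rpow_def_of_pos hi]
    congr 1
    ring
  have e2 : Real.exp (t i ^ 2 / (2 * v' i) -
      (L i - Real.log (L i) / 2 - Real.log (2 * √Real.pi) + x)) =
      Real.exp (t i ^ 2 / (2 * v' i)) * √(L i) * (2 * √Real.pi) /
        (Real.exp (L i) * Real.exp x) := by
    rw [← e1]
    conv_rhs => rw [← Real.exp_log (show 0 < 2 * √Real.pi by positivity)]
    rw [← Real.exp_add, ← Real.exp_add, ← Real.exp_add, ← Real.exp_sub]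
    congr 1
    ring
  rw [e2, Real.exp_neg, Real.sqrt_mul (by norm_num : (0 : ℝ) ≤ 2),
    Real.sqrt_mul (by norm_num : (0 : ℝ) ≤ 2)]
  have hs2 : 0 < √(2 : ℝ) := by positivity
  have hs22 : √(2 : ℝ) ^ 2 = 2 := Real.sq_sqrt (by norm_num)
  generalize t i / √(v' i) = u at *
  field_simp
  rw [hs22]

end gumbelThreshold

/-! ### The maximum degree -/

section maxDegree

open Filter Topology MeasureTheory

/-- The slope s of the log-tail at the shifted threshold is at most 4t/v by the hazard rate bound,
and t ≤ v/8 yields s ≤ 1/2 as the second moment bound requires. -/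
theorem sum_binomTerm_mul_binomTail_sq_le {N M m : ℕ} {p t v : ℝ} (h0 : 0 < p) (h1 : p < 1)
    (hv : v = N * p * (1 - p)) (hm : ⌊p * M⌋₊ < m) (ht : t = (m - ⌊p * M⌋₊ : ℕ) - N * p)
    (ht0 : 0 < t) (htv : t ≤ v / 8) (hvt : v ≤ t ^ 2) :
    ∑ z ∈ Finset.range (M + 1), binomTerm M p z * binomTail N p (m - z) ^ 2 ≤
      binomTail N p (m - ⌊p * M⌋₊) ^ 2 *
        Real.exp (8 * (t / v) + 64 * (t / v) ^ 2 * (M * p * (1 - p))) := by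
  obtain ⟨a, ha⟩ : ∃ a, m = ⌊p * M⌋₊ + (a + 1) := ⟨m - ⌊p * M⌋₊ - 1, by omega⟩
  have hma : m - ⌊p * M⌋₊ = a + 1 := by omega
  rw [hma] at ht ⊢
  have hv0 : 0 < v := by linarith
  have hN : a + 1 ≤ N := by
    have h2 : v ≤ N * (1 - p) := by
      rw [hv, mul_right_comm]
      exact mul_le_of_le_one_right (mul_nonneg (by positivity) (by linarith)) h1.le
    have : ((a + 1 : ℕ) : ℝ) ≤ N := by linarith
    exact_mod_cast this
  have hpos : 0 < binomTail N p (a + 1) := binomTail_pos h0 h1 hN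
  have hpos' : 0 < binomTail N p a := hpos.trans_le (binomTail_antitone h0.le h1.le (Nat.le_succ a))
  set s := Real.log (binomTail N p a / binomTail N p (a + 1)) with hs
  have hs0 : 0 ≤ s := Real.log_nonneg <| (one_le_div hpos).2 <|
    binomTail_antitone h0.le h1.le (Nat.le_succ a)
  have htv0 : 0 < t / v := div_pos ht0 hv0
  have hs4 : s ≤ 4 * (t / v) := by
    have h := binomTail_le_mul_succ h0 h1 hv ht ht0 (by linarith) hvt
    rw [← div_le_iff₀ hpos] at h
    refine (Real.log_le_sub_one_of_pos (by positivity)).trans ?_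
    rw [mul_div_assoc] at h
    linarith
  have htv1 : t / v ≤ 1 / 8 := by rw [div_le_iff₀ hv0]; linarith
  have hexp : binomTail N p a = binomTail N p (a + 1) * Real.exp s := by
    rw [hs, Real.exp_log (by positivity), mul_div_cancel₀ _ hpos.ne']
  have key := sum_binomTerm_mul_sq_le (f := binomTail N p) (binomTail_mul_le h0 h1)
    (binomTail_nonneg h0.le h1.le) (binomTail_antitone h0.le h1.le) hexp hpos hs0 (by linarith)
    (M := M) h0.le h1.le (z₀ := ⌊p * M⌋₊) (Nat.lt_floor_add_one _).le
  rw [← ha] at key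
  refine key.trans (mul_le_mul_of_nonneg_left (Real.exp_le_exp.2 ?_) (by positivity))
  have hMpq : 0 ≤ M * p * (1 - p) := mul_nonneg (by positivity) (by linarith)
  have hs2 : 4 * s ^ 2 ≤ 64 * (t / v) ^ 2 := by nlinarith
  have := mul_le_mul_of_nonneg_right hs2 hMpq
  linarith

/-- Among the possible edges at one vertex, a proportion (k-1)/(n-1) contains a given second vertex;
this governs the loss of variance. -/
theorem choose_div_choose_sub_one {n k : ℕ} (hk : 2 ≤ k) (hkn : k ≤ n) :
    ((n - 2).choose (k - 1) : ℝ) / (n - 1).choose (k - 1) - 1 = -((k - 1) / (n - 1)) := by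
  obtain ⟨n, rfl⟩ := Nat.exists_eq_add_of_le' (hk.trans hkn)
  obtain ⟨k, rfl⟩ := Nat.exists_eq_add_of_le' (show 1 ≤ k by omega)
  simp only [Nat.add_sub_cancel, show n + 2 - 1 = n + 1 by omega]
  have h := Nat.choose_mul_succ_eq n k
  have h' : (n.choose k : ℝ) * (n + 1) = (n + 1).choose k * (n + 1 - k) := by
    rw [← Nat.cast_add_one, ← Nat.cast_sub (by omega)]
    exact_mod_cast h
  have hpos : (0 : ℝ) < (n + 1).choose k := by exact_mod_cast Nat.choose_pos (by omega)
  have hn : (n : ℝ) + 1 ≠ 0 := by positivity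
  push_cast
  have hn2 : (n : ℝ) + 2 - 1 ≠ 0 := by rw [show (n : ℝ) + 2 - 1 = n + 1 by ring]; exact hn
  field_simp
  linear_combination h'

variable {k : ℕ → ℕ} {p : ℕ → unitInterval}

theorem tendsto_binomialHypergraph_real_maxHyperDegree_le
    (hk : ∀ᶠ n : ℕ in atTop, 2 ≤ k n ∧ k n ≤ n)
    (hp : ∀ᶠ n : ℕ in atTop, 0 < (p n : ℝ) ∧ (p n : ℝ) < 1)
    (hdeg : Asymptotics.IsLittleO atTop (fun n : ℕ => Real.log (n : ℝ) ^ 3)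
      (fun n : ℕ => ((n - 1).choose (k n - 1) : ℝ) * (p n : ℝ) * (1 - (p n : ℝ))))
    (hsize : Asymptotics.IsLittleO atTop (fun n : ℕ => (k n : ℝ))
      (fun n : ℕ => (n : ℝ) / Real.log (n : ℝ) ^ 2)) (x : ℝ) :
    Tendsto (fun n : ℕ => (binomialHypergraph n (k n) (p n)).real
      {H | ((maxHyperDegree H : ℝ) - gumbelCenter n ((n - 1).choose (k n - 1)) (p n : ℝ)) /
          gumbelScale n ((n - 1).choose (k n - 1)) (p n : ℝ) ≤ x}) atTop
      (𝓝 (Real.exp (-Real.exp (-x)))) := by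
  let L : ℕ → ℝ := fun n => Real.log n
  let N : ℕ → ℕ := fun n => (n - 1).choose (k n - 1)
  let N' : ℕ → ℕ := fun n => (n - 2).choose (k n - 1)
  let q : ℕ → ℝ := fun n => p n
  let v : ℕ → ℝ := fun n => N n * q n * (1 - q n)
  let v' : ℕ → ℝ := fun n => N' n * q n * (1 - q n)
  let τ : ℕ → ℝ := fun n => √(2 * v n * L n) * (1 - Real.log (L n) / (4 * L n) -
    Real.log (2 * √Real.pi) / (2 * L n)) + x * √(v n / (2 * L n))
  let y : ℕ → ℝ := fun n => gumbelCenter n (N n) (q n) + x * gumbelScale n (N n) (q n)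
  have hy (n) : y n = N n * q n + τ n := by
    simp only [y, τ, gumbelCenter, gumbelScale, v, L]
    rw [show 2 * (N n * q n * (1 - q n)) * Real.log n = 2 * N n * q n * (1 - q n) * Real.log n by
      ring]
    ring
  let m : ℕ → ℕ := fun n => ⌊y n⌋₊ + 1
  -- Threshold left for the private edges once the rounded mean of the shared ones is removed.
  let m' : ℕ → ℕ := fun n => m n - ⌊q n * (N n - N' n : ℕ)⌋₊
  let t : ℕ → ℝ := fun n => m n - N n * q n
  let t' : ℕ → ℝ := fun n => m' n - N' n * q n
  have hL : Tendsto L atTop atTop := Real.tendsto_log_atTop.comp tendsto_natCast_atTop_atTop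
  have hNpos : ∀ᶠ n in atTop, 0 < N n := hk.mono fun n h => Nat.choose_pos (by omega)
  have hvpos : ∀ᶠ n in atTop, 0 < v n := by
    filter_upwards [hp, hNpos] with n h hN
    have hN' : (0 : ℝ) < N n := by exact_mod_cast hN
    exact mul_pos (mul_pos hN' h.1) (by linarith [h.2])
  have hv : Tendsto (fun n => L n ^ 3 / v n) atTop (𝓝 0) := hdeg.tendsto_div_nhds_zero
  have hv' : Tendsto (fun n => L n * (v' n / v n - 1)) atTop (𝓝 0) := by
    refine squeeze_zero_norm' ?_ hsize.tendsto_div_nhds_zero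
    filter_upwards [hk, hp, hNpos, hL.eventually_ge_atTop 1] with n hkn hpn hN hL1
    have e : v' n / v n = (N' n : ℝ) / N n := by
      have h1 : (1 : ℝ) - q n ≠ 0 := by linarith [hpn.2]
      have h2 : q n ≠ 0 := hpn.1.ne'
      simp only [v, v']
      rw [mul_div_mul_right _ _ h1, mul_div_mul_right _ _ h2]
    rw [e, choose_div_choose_sub_one hkn.1 hkn.2, mul_neg, norm_neg, Real.norm_eq_abs]
    have hk2 : (2 : ℝ) ≤ k n := by exact_mod_cast hkn.1
    have hkn' : (k n : ℝ) ≤ n := by exact_mod_cast hkn.2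
    have h3 : ((k n : ℝ) - 1) / (n - 1) ≤ k n / n := by
      rw [div_le_div_iff₀ (by linarith) (by linarith)]
      nlinarith
    have h4 : 0 ≤ ((k n : ℝ) - 1) / (n - 1) := div_nonneg (by linarith) (by linarith)
    rw [abs_of_nonneg (mul_nonneg (by linarith) h4), div_div_eq_mul_div]
    calc L n * (((k n : ℝ) - 1) / (n - 1)) ≤ L n ^ 2 * (k n / n) :=
          mul_le_mul (le_self_pow₀ hL1 two_ne_zero) h3 h4 (by positivity)
      _ = _ := by simp only [L]; ring
  have hv1 : Tendsto (fun n => L n * (v n / v n - 1)) atTop (𝓝 0) := by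
    refine tendsto_const_nhds.congr' (f₁ := fun _ => 0) ?_
    filter_upwards [hvpos] with n h
    rw [div_self h.ne', sub_self, mul_zero]
  have hτpos : ∀ᶠ n in atTop, 0 < τ n := by
    have h := (tendsto_threshold (t := τ) (c := Real.log (2 * √Real.pi)) (x := x) hL hvpos hv hv1
      (Eventually.of_forall fun n => by simp [τ])).1
    filter_upwards [(moderate_of_threshold hL hvpos hv hv1 h).1.eventually_gt_atTop 0, hvpos]
      with n h1 h2
    exact (div_pos_iff_of_pos_right (Real.sqrt_pos.2 h2)).1 h1
  have hmy : ∀ᶠ n in atTop, 0 ≤ y n ∧ 0 ≤ t n - τ n ∧ t n - τ n ≤ 1 := by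
    filter_upwards [hτpos, hp] with n h1 h2
    have hy0 : 0 ≤ y n := by
      rw [hy]
      have := h2.1
      positivity
    have e : t n - τ n = ⌊y n⌋₊ + 1 - y n := by
      simp only [t, m]
      rw [hy]
      push_cast
      ring
    exact ⟨hy0, by rw [e]; linarith [Nat.lt_floor_add_one (y n)],
      by rw [e]; linarith [Nat.floor_le hy0]⟩
  obtain ⟨hr, hr2⟩ := tendsto_threshold (t := t) (c := Real.log (2 * √Real.pi)) (x := x)
    hL hvpos hv hv1 (hmy.mono fun n h => abs_le.2 ⟨by linarith [h.2.1], by linarith [h.2.2]⟩)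
  obtain ⟨hmod1, hmod2⟩ := moderate_of_threshold hL hvpos hv hv1 hr
  have hNN' (n) : N' n ≤ N n := Nat.choose_le_choose _ (by omega)
  have hfloor : ∀ᶠ n in atTop, ⌊q n * (N n - N' n : ℕ)⌋₊ < m n := by
    filter_upwards [hmy, hτpos, hp] with n h1 h2 h3
    have h4 := Nat.floor_le (a := q n * (N n - N' n : ℕ)) (mul_nonneg h3.1.le (by positivity))
    have h5 : q n * (N n - N' n : ℕ) ≤ q n * N n :=
      mul_le_mul_of_nonneg_left (by exact_mod_cast Nat.sub_le _ _) h3.1.le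
    have h6 : (⌊q n * (N n - N' n : ℕ)⌋₊ : ℝ) < m n := by
      have : 0 < m n - N n * q n := by
        have := h1.2.1
        simp only [t] at this
        linarith
      linarith
    exact_mod_cast h6
  -- Rounding to m and rounding the shared mean each move the deviation by at most 1, within the
  -- tolerance 2.
  obtain ⟨hr', hr2'⟩ := tendsto_threshold (t := t') (c := Real.log (2 * √Real.pi)) (x := x)
    hL hvpos hv hv' (by
      filter_upwards [hmy, hfloor, hp] with n h h1 h2
      have e : t' n - t n = q n * (N n - N' n : ℕ) - ⌊q n * (N n - N' n : ℕ)⌋₊ := by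
        simp only [t', t, m']
        rw [Nat.cast_sub h1.le, Nat.cast_sub (hNN' n)]
        ring
      have h4 := Nat.floor_le (a := q n * (N n - N' n : ℕ)) (mul_nonneg h2.1.le (by positivity))
      have h5 := Nat.lt_floor_add_one (q n * (N n - N' n : ℕ))
      exact abs_le.2 ⟨by linarith [h.2.1], by linarith [h.2.2]⟩)
  obtain ⟨hmod1', hmod2'⟩ := moderate_of_threshold hL hvpos hv hv' hr'
  have hexpL : ∀ᶠ n : ℕ in atTop, Real.exp (L n) = n := by
    filter_upwards [eventually_gt_atTop 0] with n hn
    exact Real.exp_log (by exact_mod_cast hn)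
  have hlam : Tendsto (fun n : ℕ => n * binomTail (N n) (q n) (m n)) atTop (𝓝 (Real.exp (-x))) := by
    refine (tendsto_exp_mul_binomTail hL hp (fun _ => rfl) (fun _ => rfl) hmod1 hmod2 hr hr2).congr' ?_
    filter_upwards [hexpL] with n h
    rw [h]
  have hlam' : Tendsto (fun n : ℕ => n * binomTail (N' n) (q n) (m' n)) atTop
      (𝓝 (Real.exp (-x))) := by
    refine (tendsto_exp_mul_binomTail hL hp (fun _ => rfl) (fun _ => rfl) hmod1' hmod2' hr'
      hr2').congr' ?_
    filter_upwards [hexpL] with n h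
    rw [h]
  have htv' := tendsto_div_of_moderate hmod1' hmod2'
  let X : ℕ → ℝ := fun n => 8 * (t' n / v' n) +
    64 * (t' n / v' n) ^ 2 * ((N n - N' n : ℕ) * q n * (1 - q n))
  have hX : Tendsto X atTop (𝓝 0) := by
    -- With (t'/v')² (v - v') = (t'²/v')/(2L) · 2L(v/v' - 1), the constant 64 becomes 128.
    have h := (htv'.const_mul 8).add (((hr'.pow 2).mul
      (tendsto_mul_inv_sub_one hL hvpos hv')).const_mul 128)
    simp only [mul_zero, add_zero] at h
    refine h.congr' ?_
    filter_upwards [eventually_one_le_of_moderate hmod1', hL.eventually_gt_atTop 0] with n h1 h2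
    have e : ((N n - N' n : ℕ) : ℝ) * q n * (1 - q n) = v n - v' n := by
      rw [Nat.cast_sub (hNN' n)]
      simp only [v, v']
      ring
    have hv0 := h1.1
    simp only [X]
    rw [e, div_pow, div_pow, Real.sq_sqrt hv0.le, Real.sq_sqrt (by positivity)]
    field_simp
    ring
  -- After multiplication by n², both terms tend to e^{-2x}. The absolute value only serves to make
  -- δ nonnegative.
  let δ : ℕ → ℝ := fun n => |binomTail (N' n) (q n) (m' n) ^ 2 * Real.exp (X n) -
    binomTail (N n) (q n) (m n) ^ 2|
  have hδ : Tendsto (fun n : ℕ => (n : ℝ) ^ 2 * δ n) atTop (𝓝 0) := by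
    have h := (((hlam'.pow 2).mul ((Real.continuous_exp.tendsto 0).comp hX)).sub (hlam.pow 2)).abs
    rw [Real.exp_zero, mul_one, sub_self, abs_zero] at h
    refine h.congr fun n => ?_
    simp only [δ, Function.comp_apply]
    rw [← abs_of_nonneg (sq_nonneg (n : ℝ)), ← abs_mul]
    congr 1
    ring
  have hsq : Tendsto (fun n : ℕ => n * binomTail (N n) (q n) (m n) ^ 2) atTop (𝓝 0) := by
    have h := (hlam.pow 2).mul (tendsto_inv_atTop_zero.comp tendsto_natCast_atTop_atTop)
    rw [mul_zero] at h
    refine h.congr' ?_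
    filter_upwards [eventually_gt_atTop 0] with n hn
    have : (n : ℝ) ≠ 0 := by exact_mod_cast hn.ne'
    simp only [Function.comp_apply]
    field_simp
  have hdiff : Tendsto (fun n : ℕ => (binomialHypergraph n (k n) (p n)).real
      {H | maxHyperDegree H < m n} - Real.exp (-(n * binomTail (N n) (q n) (m n)))) atTop
      (𝓝 0) := by
    have h := hsq.add hδ
    rw [add_zero] at h
    refine squeeze_zero_norm' ?_ h
    filter_upwards [hk, hp, hfloor, eventually_one_le_of_moderate hmod1',
      htv'.eventually_le_const (show (0 : ℝ) < 1 / 8 by norm_num)] with n h1 h2 h3 h4 h5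
    have hs := Real.sqrt_pos.2 h4.1
    refine abs_binomialHypergraph_real_maxHyperDegree_lt_sub_exp_le (Nat.succ_pos _) (by omega)
      (abs_nonneg _) rfl rfl ?_
    refine (sum_binomTerm_mul_binomTail_sq_le (v := v' n) (t := t' n) h2.1 h2.2 rfl h3 rfl
      (hs.trans_le h4.2) ?_ ?_).trans ?_
    · rw [div_le_iff₀ h4.1] at h5
      linarith
    · rw [← Real.sq_sqrt h4.1.le]
      exact pow_le_pow_left₀ hs.le h4.2 2
    · have := le_abs_self (binomTail (N' n) (q n) (m' n) ^ 2 * Real.exp (X n) -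
        binomTail (N n) (q n) (m n) ^ 2)
      linarith
  have hfin := hdiff.add ((Real.continuous_exp.tendsto _).comp hlam.neg)
  rw [zero_add] at hfin
  refine hfin.congr' ?_
  filter_upwards [hmy, hvpos, hL.eventually_gt_atTop 0] with n h1 h2 h3
  simp only [Function.comp_apply, sub_add_cancel]
  congr 1
  ext H
  have hb : 0 < gumbelScale n (N n) (q n) := Real.sqrt_pos.2 (by
    have : 0 < v n / (2 * L n) := by positivity
    exact this)
  simp only [Set.mem_ofPred_eq]
  rw [div_le_iff₀ hb, sub_le_iff_le_add', Nat.lt_succ_iff, Nat.le_floor_iff h1.1]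

end maxDegree

theorem mainTheorem4 (k : ℕ → ℕ) (p : ℕ → unitInterval)
    (hk : ∀ᶠ n : ℕ in Filter.atTop, 2 ≤ k n ∧ k n ≤ n)
    (hp : ∀ᶠ n : ℕ in Filter.atTop, 0 < (p n : ℝ) ∧ (p n : ℝ) < 1)
    (hdeg : Asymptotics.IsLittleO Filter.atTop
      (fun n : ℕ => Real.log (n : ℝ) ^ 3)
      (fun n : ℕ => ((n - 1).choose (k n - 1) : ℝ) * (p n : ℝ) * (1 - (p n : ℝ))))
    (hsize : Asymptotics.IsLittleO Filter.atTop
      (fun n : ℕ => (k n : ℝ))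
      (fun n : ℕ => (n : ℝ) / Real.log (n : ℝ) ^ 2)) :
    MeasureTheory.TendstoInDistribution
      (fun (n : ℕ) (H : Set (Finset (Fin n))) =>
        ((maxHyperDegree H : ℝ) - gumbelCenter n ((n - 1).choose (k n - 1)) (p n : ℝ)) /
          gumbelScale n ((n - 1).choose (k n - 1)) (p n : ℝ))
      Filter.atTop
      (fun x : ℝ => x)
      (fun n : ℕ => binomialHypergraph n (k n) (p n))
      gumbelMeasure := by

  have hmeas (n : ℕ) : Measurable (fun H : Set (Finset (Fin n)) =>
      ((maxHyperDegree H : ℝ) - gumbelCenter n ((n - 1).choose (k n - 1)) (p n : ℝ)) /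
        gumbelScale n ((n - 1).choose (k n - 1)) (p n : ℝ)) := .of_discrete
  refine ⟨fun n => (hmeas n).aemeasurable, aemeasurable_id', ?_⟩
  refine tendsto_probabilityMeasure_of_tendsto_cdf fun x => ?_
  have hlim : (gumbelMeasure.map fun x : ℝ => x).real (Set.Iic x) =
      Real.exp (-Real.exp (-x)) := by
    rw [MeasureTheory.Measure.map_id', ← ProbabilityTheory.cdf_eq_real, cdf_gumbelMeasure]
  simp only [MeasureTheory.ProbabilityMeasure.coe_mk]
  rw [hlim]
  simp only [MeasureTheory.map_measureReal_apply (hmeas _) measurableSet_Iic]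
  exact tendsto_binomialHypergraph_real_maxHyperDegree_le hk hp hdeg hsize x
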